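/- **Conventions.** Algorithms are deterministic word-RAM programs: a fixed finite program with registers and a memory that initially holds the input (everything else being $0$), whose instructions (constants, arithmetic, bitwise operations and shifts, indirect loads and stores, jumps, jumps on zero) cost one step each, and which on every input only handles words of $O(\log N)$ bits, where $N$ is the number of input words plus the largest input word. A graph is a finite simple undirected graph, given by its number of nodes $n$, its number of edges $m$ and a list of its $m$ edges; detecting a 4-cycle means deciding whether it has a simple, not necessarily induced, cycle of length 4. A permutation of length $n$ is given by $n$ and the list of its values. For permutations $\sigma$ of length $4$ (a *4-pattern*) and $\pi$ of length $n$, an *occurrence* of $\sigma$ in $\pi$ is a sequence of indices $i_1<i_2<i_3<i_4$ such that $\sigma(j)<\sigma(j')$ iff $\pi(i_j)<\pi(i_{j'})$ for all $j,j'$; *counting* $\sigma$ in $\pi$ means computing the number of its occurrences. The pattern $\sigma$ is *non-trivial* if for some permutation $\pi$ and some vertical and horizontal line, neither passing through a point $(i,\pi(i))$, there is an occurrence of $\sigma$ in $\pi$ whose four points $(i_j,\pi(i_j))$ lie in four different quadrants. (These are the 16 patterns other than $1234,1243,2134,2143,4321,4312,3421,3412$.) **Conjecture (Dahlgaard, Knudsen,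 Stöckel).** For every $\varepsilon>0$, there is no algorithm that detects a 4-cycle in a graph with $m$ edges in $O(m^{4/3-\varepsilon})$ time. **Theorem.** If this conjecture holds, then for every $\varepsilon>0$ and every non-trivial 4-pattern $\sigma$, there is no algorithm that counts $\sigma$ in permutations of length $n$ in $O(n^{4/3-\varepsilon})$ time. -/

import Mathlib

open Asymptotics Filter

/-! ## A word RAM with a step count -/

namespace WordRAM

/-- Binary word operations; subtraction is truncated at `0`, division by `0` gives `0`. -/
inductive Op where
  | add | sub | mul | div | mod | and | or | xor | shl | shr

/-- The value of a word operation. -/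
def Op.eval : Op → ℕ → ℕ → ℕ
  | .add, x, y => x + y
  | .sub, x, y => x - y
  | .mul, x, y => x * y
  | .div, x, y => x / y
  | .mod, x, y => x % y
  | .and, x, y => x &&& y
  | .or, x, y => x ||| y
  | .xor, x, y => x ^^^ y
  | .shl, x, y => x <<< y
  | .shr, x, y => x >>> y

/-- Instructions. The arguments are numbers of registers, except for the constant `k` of `const`
and the jump targets `l`. -/
inductive Instr where
  /-- `R[d] := k` -/
  | const (d k : ℕ)
  /-- `R[d] := R[a] o R[b]` -/
  | op (o : Op) (d a b : ℕ)
  /-- `R[d] := M[R[a]]` -/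
  | load (d a : ℕ)
  /-- `M[R[a]] := R[b]` -/
  | store (a b : ℕ)
  /-- go to instruction `l` -/
  | jump (l : ℕ)
  /-- go to instruction `l` if `R[a] = 0`, and to the next instruction otherwise -/
  | jumpZero (a l : ℕ)

/-- A program is a finite list of instructions. It uses only the finitely many registers that it
names, and it does not depend on the input. -/
abbrev Program := List Instr

/-- A configuration: program counter, registers, memory. -/
structure State where
  pc : ℕ
  reg : ℕ → ℕ
  mem : ℕ → ℕ

/-- The effect of one instruction. -/
def Instr.exec : Instr → State → State
  | .const d k, s => ⟨s.pc + 1, Function.update s.reg d k, s.mem⟩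
  | .op o d a b, s => ⟨s.pc + 1, Function.update s.reg d (o.eval (s.reg a) (s.reg b)), s.mem⟩
  | .load d a, s => ⟨s.pc + 1, Function.update s.reg d (s.mem (s.reg a)), s.mem⟩
  | .store a b, s => ⟨s.pc + 1, s.reg, Function.update s.mem (s.reg a) (s.reg b)⟩
  | .jump l, s => ⟨l, s.reg, s.mem⟩
  | .jumpZero a l, s => ⟨if s.reg a = 0 then l else s.pc + 1, s.reg, s.mem⟩

/-- One step of a program. The program has halted when the program counter does not point to an
instruction; the configuration does not change any more then. -/
def step (p : Program) (s : State) : State :=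
  match p[s.pc]? with
  | some i => i.exec s
  | none => s

/-- The program has halted. -/
def Halted (p : Program) (s : State) : Prop := p.length ≤ s.pc

/-- The initial configuration: the input words stand in the memory cells `0, 1, 2, …`;
all other cells and all registers are `0`. -/
def init (input : List ℕ) : State := ⟨0, fun _ => 0, fun a => input.getD a 0⟩

/-- The configuration after `t` steps on a given input. -/
def run (p : Program) (input : List ℕ) (t : ℕ) : State := (step p)^[t] (init input)

/-- The number `N` that the word length is logarithmic in: the number of input words plus the
largest input word. -/
def magnitude (input : List ℕ) : ℕ := input.length + input.foldr max 0

/-- During the run on this input, all registers and all memory cells hold words of at most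
`c * log₂ (N + 2)` bits, that is, numbers less than `(N + 2) ^ c`. -/
def WordsBounded (p : Program) (c : ℕ) (input : List ℕ) : Prop :=
  ∀ t a, (run p input t).reg a < (magnitude input + 2) ^ c ∧
    (run p input t).mem a < (magnitude input + 2) ^ c

/-- A computational problem: its inputs, how they are written as a list of words, the parameter
in which the running time is measured, and the correct answer (for a decision problem, `1` for
yes and `0` for no). -/
structure Problem where
  Input : Type
  encode : Input → List ℕ
  size : Input → ℕ
  answer : Input → ℕ

/-- The program, run with words of `O(log N)` bits, solves the problem, and on every input `x` it
halts after at most `T (size x)` steps. The answer is in register `0`. -/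
def SolvesInTime (p : Program) (P : Problem) (T : ℕ → ℕ) : Prop :=
  (∃ c : ℕ, ∀ x : P.Input, WordsBounded p c (P.encode x)) ∧
    ∀ x : P.Input, Halted p (run p (P.encode x) (T (P.size x))) ∧
      (run p (P.encode x) (T (P.size x))).reg 0 = P.answer x

/-- There is an algorithm that solves the problem in `O(f(size))` time. -/
def SolvableInTime (P : Problem) (f : ℕ → ℝ) : Prop :=
  ∃ (p : Program) (T : ℕ → ℕ), SolvesInTime p P T ∧ (fun n => (T n : ℝ)) =O[atTop] f

end WordRAM

/-! ## Detecting 4-cycles -/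

/-- A finite simple undirected graph on the nodes `0, …, n - 1`, given by a list in which every
edge occurs exactly once, in one of its two orientations; the order of the list is arbitrary. -/
structure GraphInput where
  n : ℕ
  graph : SimpleGraph (Fin n)
  edges : List (Fin n × Fin n)
  mem_edges : ∀ u v, graph.Adj u v ↔ (u, v) ∈ edges ∨ (v, u) ∈ edges
  nodup : (edges.map fun e => s(e.1, e.2)).Nodup

/-- The input words: `n`, `m`, and then the two endpoints of each of the `m` edges. -/
def GraphInput.encode (x : GraphInput) : List ℕ :=
  x.n :: x.edges.length :: x.edges.flatMap fun e => [(e.1 : ℕ), (e.2 : ℕ)]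

/-- The graph has a simple cycle of length 4 (not necessarily induced). -/
def HasFourCycle {V : Type*} (G : SimpleGraph V) : Prop :=
  ∃ (v : V) (w : G.Walk v v), w.IsCycle ∧ w.length = 4

open Classical in
/-- Detecting a 4-cycle in a graph; the parameter is the number `m` of edges. -/
noncomputable def fourCycleDetection : WordRAM.Problem where
  Input := GraphInput
  encode := GraphInput.encode
  size x := x.edges.length
  answer x := if HasFourCycle x.graph then 1 else 0

/-- The conjecture of Dahlgaard, Knudsen and Stöckel: for every `ε > 0`, there is no algorithm
that detects a 4-cycle in a graph with `m` edges in `O(m ^ (4/3 - ε))` time. -/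
def DahlgaardKnudsenStockelConjecture : Prop :=
  ∀ ε : ℝ, 0 < ε →
    ¬ WordRAM.SolvableInTime fourCycleDetection (fun m => (m : ℝ) ^ (4 / 3 - ε : ℝ))

/-! ## Counting patterns -/

/-- The increasing sequence of indices `f` is an occurrence of the `k`-pattern `σ` in `π`. -/
def IsOccurrence {k n : ℕ} (σ : Equiv.Perm (Fin k)) (π : Equiv.Perm (Fin n))
    (f : Fin k ↪o Fin n) : Prop :=
  ∀ j j', σ j < σ j' ↔ π (f j) < π (f j')

/-- The number of occurrences of the `k`-pattern `σ` in `π`. -/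
noncomputable def patternCount {k n : ℕ} (σ : Equiv.Perm (Fin k)) (π : Equiv.Perm (Fin n)) : ℕ :=
  Nat.card {f : Fin k ↪o Fin n // IsOccurrence σ π f}

/-- A 4-pattern is non-trivial if, for some permutation `π` and some division of the plane by a
vertical line `x = v` and a horizontal line `y = h` that pass through none of the points
`(i, π i)`, some occurrence of the pattern in `π` has exactly one point in each of the four
quadrants. -/
def IsNontrivialPattern (σ : Equiv.Perm (Fin 4)) : Prop :=
  ∃ (n : ℕ) (π : Equiv.Perm (Fin n)) (f : Fin 4 ↪o Fin n) (v h : ℝ),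
    IsOccurrence σ π f ∧
    (∀ i : Fin n, ((i : ℕ) : ℝ) ≠ v ∧ ((π i : ℕ) : ℝ) ≠ h) ∧
    (∃! j, ((f j : ℕ) : ℝ) < v ∧ h < ((π (f j) : ℕ) : ℝ)) ∧
    (∃! j, v < ((f j : ℕ) : ℝ) ∧ h < ((π (f j) : ℕ) : ℝ)) ∧
    (∃! j, ((f j : ℕ) : ℝ) < v ∧ ((π (f j) : ℕ) : ℝ) < h) ∧
    (∃! j, v < ((f j : ℕ) : ℝ) ∧ ((π (f j) : ℕ) : ℝ) < h)

/-- Counting the pattern `σ` in a permutation; the parameter is the length `n` of the permutation.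
The input words are `n` and then the `n` values of the permutation. -/
noncomputable def patternCounting {k : ℕ} (σ : Equiv.Perm (Fin k)) : WordRAM.Problem where
  Input := Σ n : ℕ, Equiv.Perm (Fin n)
  encode x := x.1 :: List.ofFn fun i => (x.2 i : ℕ)
  size x := x.1
  answer x := patternCount σ x.2

/-!
A fast program `p` that counts a non-trivial pattern `σ` is turned into a fast program that detects
4-cycles. The reduction needs 16 calls of `p` on permutations of length `8 * m` and linear time
otherwise.

Let `L = 2 * m` be the number of oriented edges. Homomorphisms from the 4-cycle to the graph
correspond to quadruples of oriented edges of the form `(a, b)`, `(a, d)`, `(c, b)`, `(c, d)`. They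
are the rectangles among the following points: the plane is divided into four quadrants, and each
quadrant gets a copy of every oriented edge, with the source as abscissa and the target as
ordinate. Such a point set is not a permutation, since many points are on a common line; the
ties between the two quadrants in the same half of the plane can be broken in two ways, and there
are four halves (left, right, lower, upper). Consider the alternating sum of the numbers of
occurrences of `σ` over the 16 ways to break the ties.
* A quadruple of points that misses a quadrant cancels, because the ties in a half that contains
  this quadrant do not matter for it (`Grouping.exists_of_altSum_ne_zero`).
* In a quadruple with one point in each quadrant, the order of the points is determined by one
  comparison in each half. Since `σ` is non-trivial, its contribution is `1` if all four
  comparisons are ties, which means that it is a rectangle, and `0` otherwise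
  (`Grouping.altSum_of_fst_eq`).

So the alternating sum is the number of rectangles (`Grouping.altCount_eq_card`). Exactly
`2 * D - L` of these are degenerate, with `a = c` or `b = d`, where `D` is the sum of the squares
of the degrees, and the graph has a 4-cycle if and only if there are more
(`GraphInput.hasFourCycle_iff_altCount`).

To run this on the word RAM, the edges are sorted by their sources, with the nodes in the order of
their first appearance: node names index tables in the memory directly, so that this takes linear
time even if the number of nodes is not bounded in terms of `m`. Each call of `p` is simulated in a
fresh array and with fresh registers, since `p` expects both to be `0`. The program is written in a
small structured language whose arrays are interleaved in the memory; `WordRAM.Com.Wp` is its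
program logic, which keeps track of running time and word length, `WordRAM.Com.wp_call` is the rule
for simulating `p`, and `FourCycleProgram.program_reaches` is the correctness of the whole program.
-/

namespace WordRAM

/-! ### Bounded runs of a program fragment -/

/-- All registers and all memory cells hold numbers below `b`. -/
def State.Bounded (b : ℕ) (s : State) : Prop := ∀ a, s.reg a < b ∧ s.mem a < b

/-- `Reaches p b t s s'`: the program `p` leads from `s` to `s'` in `t` steps, and all
configurations on the way, including both ends, hold only words below `b`. -/
inductive Reaches (p : Program) (b : ℕ) : ℕ → State → State → Prop
  | refl {s : State} (hs : s.Bounded b) : Reaches p b 0 s s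
  | head {t : ℕ} {s s' : State} (hs : s.Bounded b) (h : Reaches p b t (step p s) s') :
      Reaches p b (t + 1) s s'

theorem Reaches.trans {p : Program} {b t t' : ℕ} {s s' s'' : State} (h : Reaches p b t s s')
    (h' : Reaches p b t' s' s'') : Reaches p b (t + t') s s'' := by
  induction h with
  | refl hs => simpa using h'
  | head hs h ih => rw [Nat.add_right_comm]; exact .head hs (ih h')

theorem Reaches.exec {p : Program} {b t : ℕ} {s s' : State} {i : Instr} (hs : s.Bounded b)
    (hi : p[s.pc]? = some i) (h : Reaches p b t (i.exec s) s') : Reaches p b (t + 1) s s' := by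
  refine .head hs ?_
  simpa [step, hi] using h

theorem Reaches.bounded_end {p : Program} {b t : ℕ} {s s' : State} (h : Reaches p b t s s') :
    s'.Bounded b := by
  induction h with
  | refl hs => exact hs
  | head _ _ ih => exact ih

theorem Reaches.iterate_eq {p : Program} {b t : ℕ} {s s' : State} (h : Reaches p b t s s') :
    (step p)^[t] s = s' := by
  induction h with
  | refl hs => rfl
  | head hs h ih => exact ih

theorem Reaches.bounded_iterate {p : Program} {b t : ℕ} {s s' : State} (h : Reaches p b t s s') :
    ∀ i ≤ t, ((step p)^[i] s).Bounded b := by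
  induction h with
  | refl hs => intro i hi; obtain rfl : i = 0 := by omega
               exact hs
  | head hs h ih =>
    intro i hi
    cases i with
    | zero => exact hs
    | succ i => exact ih i (by omega)

theorem step_of_halted {p : Program} {s : State} (h : Halted p s) : step p s = s := by
  have : p[s.pc]? = none := List.getElem?_eq_none h
  simp [step, this]

theorem iterate_step_of_halted {p : Program} {s : State} (h : Halted p s) (t : ℕ) :
    (step p)^[t] s = s := Function.iterate_fixed (step_of_halted h) t

/-- A configuration reached from `s` in `t` steps with the program halted is final: the
configuration at any later time is the same, and the words stay bounded for ever. -/
theorem Reaches.iterate_of_halted {p : Program} {b t : ℕ} {s s' : State}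
    (h : Reaches p b t s s') (hh : Halted p s') :
    (∀ i, t ≤ i → (step p)^[i] s = s') ∧ ∀ i, ((step p)^[i] s).Bounded b := by
  have key : ∀ i, t ≤ i → (step p)^[i] s = s' := by
    intro i hi
    obtain ⟨k, rfl⟩ := Nat.exists_eq_add_of_le' hi
    rw [Function.iterate_add_apply, h.iterate_eq, iterate_step_of_halted hh]
  refine ⟨key, fun i => ?_⟩
  rcases le_total i t with hi | hi
  · exact h.bounded_iterate i hi
  · rw [key i hi]; exact h.bounded_end

theorem State.Bounded.update_reg {b : ℕ} {s : State} (h : s.Bounded b) (pc d : ℕ) {v : ℕ}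
    (hv : v < b) : State.Bounded b ⟨pc, Function.update s.reg d v, s.mem⟩ := by
  intro a
  refine ⟨?_, (h a).2⟩
  by_cases had : a = d
  · subst had; simpa using hv
  · simpa [Function.update_of_ne had] using (h a).1

theorem State.Bounded.update_mem {b : ℕ} {s : State} (h : s.Bounded b) (pc d : ℕ) {v : ℕ}
    (hv : v < b) : State.Bounded b ⟨pc, s.reg, Function.update s.mem d v⟩ := by
  intro a
  refine ⟨(h a).1, ?_⟩
  by_cases had : a = d
  · subst had; simpa using hv
  · simpa [Function.update_of_ne had] using (h a).2

/-- The instructions `c` stand in the program `p` from position `o` on. -/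
def CodeAt (p : Program) : ℕ → List Instr → Prop
  | _, [] => True
  | o, i :: c => p[o]? = some i ∧ CodeAt p (o + 1) c

theorem codeAt_append {p : Program} {c c' : List Instr} {o : ℕ} :
    CodeAt p o (c ++ c') ↔ CodeAt p o c ∧ CodeAt p (o + c.length) c' := by
  induction c generalizing o with
  | nil => simp [CodeAt]
  | cons i c ih => simp [CodeAt, ih, and_assoc, Nat.add_comm, Nat.add_left_comm]

theorem codeAt_self (q c r : List Instr) : CodeAt (q ++ c ++ r) q.length c := by
  induction c generalizing q with
  | nil => trivial
  | cons i c ih =>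
    refine ⟨by simp, ?_⟩
    have := ih (q ++ [i])
    simpa using this

/-! ### A structured language with arrays -/

/-- A configuration of the structured language: variables, and arrays `0, …, 31` of unbounded
length. -/
structure Store where
  var : ℕ → ℕ
  arr : ℕ → ℕ → ℕ

/-- Write to cell `i` of array `z`. -/
def Store.set (V : Store) (z i v : ℕ) : Store :=
  ⟨V.var, Function.update V.arr z (Function.update (V.arr z) i v)⟩

/-- Write to variable `d`. -/
def Store.assign (V : Store) (d v : ℕ) : Store := ⟨Function.update V.var d v, V.arr⟩

/-- Elementary commands. -/
inductive Prim where
  /-- `v[d] := k` -/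
  | const (d k : ℕ)
  /-- `v[d] := v[a] o v[b]` -/
  | op (o : Op) (d a b : ℕ)
  /-- `v[d] := A_z[v[a]]` -/
  | load (z d a : ℕ)
  /-- `A_z[v[a]] := v[b]` -/
  | store (z a b : ℕ)
  /-- `v[d] :=` input word number `v[a]` -/
  | input (d a : ℕ)

/-- What stays fixed during a run: the input, the number `base` of memory cells that are reserved
for it, and the strict upper bound on the words. -/
structure Env where
  inp : ℕ → ℕ
  base : ℕ
  bound : ℕ

/-- The effect of an elementary command. -/
def Prim.eval (E : Env) : Prim → Store → Store
  | .const d k, V => V.assign d k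
  | .op o d a b, V => V.assign d (o.eval (V.var a) (V.var b))
  | .load z d a, V => V.assign d (V.arr z (V.var a))
  | .store z a b, V => V.set z (V.var a) (V.var b)
  | .input d a, V => V.assign d (E.inp (V.var a))

/-- The command can be executed within the word bound, and it reads the input only where it is. -/
def Prim.Ok (E : Env) : Prim → Store → Prop
  | .const _ k, _ => k < E.bound
  | .op o _ a b, V => o.eval (V.var a) (V.var b) < E.bound
  | .load z _ a, V => z < 32 ∧ V.var a * 32 + 32 + E.base < E.bound
  | .store z a _, V => z < 32 ∧ V.var a * 32 + 32 + E.base < E.bound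
  | .input _ a, V => V.var a < E.base

/-- Variable `r` is kept in register `r + 3`; register `2` holds `E.base`; registers `0` and `1`
are used for address computations. The arrays are interleaved behind the input. -/
structure Rep (E : Env) (V : Store) (s : State) : Prop where
  base : s.reg 2 = E.base
  var : ∀ r, s.reg (r + 3) = V.var r
  inp : ∀ a < E.base, s.mem a = E.inp a
  arr : ∀ z < 32, ∀ i, s.mem (i * 32 + z + E.base) = V.arr z i

/-- An instruction that only clobbers the scratch register `0`. -/
def pad : Instr := .const 0 0

/-- Every elementary command is translated into exactly six instructions. -/
def Prim.code : Prim → List Instr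
  | .const d k => [.const (d + 3) k, pad, pad, pad, pad, pad]
  | .op o d a b => [.op o (d + 3) (a + 3) (b + 3), pad, pad, pad, pad, pad]
  | .load z d a => [.const 0 32, .op .mul 0 (a + 3) 0, .const 1 z, .op .add 0 0 1, .op .add 0 0 2,
      .load (d + 3) 0]
  | .store z a b => [.const 0 32, .op .mul 0 (a + 3) 0, .const 1 z, .op .add 0 0 1,
      .op .add 0 0 2, .store 0 (b + 3)]
  | .input d a => [.load (d + 3) (a + 3), pad, pad, pad, pad, pad]

theorem Prim.length_code (q : Prim) : q.code.length = 6 := by cases q <;> rfl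

theorem Rep.scratch {E : Env} {V : Store} {s : State} (h : Rep E V s) (pc : ℕ) {d : ℕ}
    (hd : d < 2) (v : ℕ) : Rep E V ⟨pc, Function.update s.reg d v, s.mem⟩ := by
  refine ⟨?_, fun r => ?_, h.inp, h.arr⟩
  · simpa [Function.update_of_ne (show 2 ≠ d by omega)] using h.base
  · simpa [Function.update_of_ne (show r + 3 ≠ d by omega)] using h.var r

theorem Rep.assign {E : Env} {V : Store} {s : State} (h : Rep E V s) (pc d v : ℕ) :
    Rep E (V.assign d v) ⟨pc, Function.update s.reg (d + 3) v, s.mem⟩ := by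
  refine ⟨?_, fun r => ?_, h.inp, h.arr⟩
  · simpa [Function.update_of_ne (show 2 ≠ d + 3 by omega)] using h.base
  · by_cases hr : r = d
    · subst hr; simp [Store.assign]
    · simpa [Store.assign, Function.update_of_ne hr,
        Function.update_of_ne (show r + 3 ≠ d + 3 by omega)] using h.var r

theorem Rep.set {E : Env} {V : Store} {s : State} (h : Rep E V s) (pc : ℕ) {z : ℕ} (hz : z < 32)
    (i v : ℕ) :
    Rep E (V.set z i v) ⟨pc, s.reg, Function.update s.mem (i * 32 + z + E.base) v⟩ := by
  refine ⟨h.base, h.var, fun a ha => ?_, fun z' hz' i' => ?_⟩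
  · simpa [Function.update_of_ne (show a ≠ i * 32 + z + E.base by omega)] using h.inp a ha
  · by_cases hzz : z' = z
    · subst hzz
      by_cases hi : i' = i
      · subst hi; simp [Store.set]
      · simpa [Store.set, Function.update_of_ne hi,
          Function.update_of_ne (show i' * 32 + z' + E.base ≠ i * 32 + z' + E.base by omega)]
          using h.arr z' hz' i'
    · simpa [Store.set, Function.update_of_ne hzz,
        Function.update_of_ne (show i' * 32 + z' + E.base ≠ i * 32 + z + E.base by omega)]
        using h.arr z' hz' i'

/-- Five padding instructions change nothing but the scratch register. -/
theorem reaches_pad {E : Env} (hE : 32 < E.bound) {p : Program} (n : ℕ) {o : ℕ} {V : Store}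
    {s : State} (hc : CodeAt p o (List.replicate n pad)) (hpc : s.pc = o) (hR : Rep E V s)
    (hs : s.Bounded E.bound) :
    ∃ s', Reaches p E.bound n s s' ∧ s'.pc = o + n ∧ Rep E V s' := by
  induction n generalizing o s with
  | zero => exact ⟨s, .refl hs, hpc, hR⟩
  | succ n ih =>
    rw [List.replicate_succ] at hc
    obtain ⟨s', h1, h2, h3⟩ := ih (s := pad.exec s) hc.2 (by simp [pad, Instr.exec, hpc])
      (hR.scratch _ (by norm_num) 0) (hs.update_reg _ _ (by omega))
    exact ⟨s', .exec hs (by rw [hpc]; exact hc.1) h1, by omega, h3⟩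

/-- The address computation: register `0` gets the address of cell `v[a]` of array `z`. -/
theorem reaches_address {E : Env} (hE : 32 < E.bound) {p : Program} {o z a : ℕ} {V : Store}
    {s : State} (hz : z < 32) (hok : V.var a * 32 + 32 + E.base < E.bound) {i : Instr}
    (hc : CodeAt p o [.const 0 32, .op .mul 0 (a + 3) 0, .const 1 z, .op .add 0 0 1,
      .op .add 0 0 2, i]) (hpc : s.pc = o) (hR : Rep E V s) (hs : s.Bounded E.bound) :
    ∃ s', Reaches p E.bound 5 s s' ∧ s'.pc = o + 5 ∧ Rep E V s' ∧
      s'.reg 0 = V.var a * 32 + z + E.base ∧ p[s'.pc]? = some i := by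
  obtain ⟨h0, h1, h2, h3, h4, h5, -⟩ := hc
  have ha := hR.var a
  have hb := hR.base
  set s1 : State := ⟨o + 1, Function.update s.reg 0 32, s.mem⟩ with hs1
  have b1 : s1.Bounded E.bound := hs.update_reg _ _ hE
  have r1 : Rep E V s1 := hR.scratch _ (by norm_num) _
  set s2 : State := ⟨o + 2, Function.update s1.reg 0 (V.var a * 32), s1.mem⟩ with hs2
  have b2 : s2.Bounded E.bound := b1.update_reg _ _ (by omega)
  have r2 : Rep E V s2 := r1.scratch _ (by norm_num) _
  set s3 : State := ⟨o + 3, Function.update s2.reg 1 z, s2.mem⟩ with hs3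
  have b3 : s3.Bounded E.bound := b2.update_reg _ _ (by omega)
  have r3 : Rep E V s3 := r2.scratch _ (by norm_num) _
  set s4 : State := ⟨o + 4, Function.update s3.reg 0 (V.var a * 32 + z), s3.mem⟩ with hs4
  have b4 : s4.Bounded E.bound := b3.update_reg _ _ (by omega)
  have r4 : Rep E V s4 := r3.scratch _ (by norm_num) _
  set s5 : State := ⟨o + 5, Function.update s4.reg 0 (V.var a * 32 + z + E.base), s4.mem⟩ with hs5
  have b5 : s5.Bounded E.bound := b4.update_reg _ _ (by omega)
  have r5 : Rep E V s5 := r4.scratch _ (by norm_num) _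
  refine ⟨s5, ?_, rfl, r5, by simp [hs5], h5⟩
  refine .exec hs (by rw [hpc]; exact h0) ?_
  have e1 : (Instr.const 0 32).exec s = s1 := by simp [Instr.exec, hs1, hpc]
  rw [e1]
  refine .exec b1 h1 ?_
  have e2 : (Instr.op .mul 0 (a + 3) 0).exec s1 = s2 := by
    simp [Instr.exec, hs2, hs1, Op.eval, ha]
  rw [e2]
  refine .exec b2 h2 ?_
  have e3 : (Instr.const 1 z).exec s2 = s3 := by simp [Instr.exec, hs3, hs2]
  rw [e3]
  refine .exec b3 h3 ?_
  have e4 : (Instr.op .add 0 0 1).exec s3 = s4 := by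
    simp [Instr.exec, hs4, hs3, hs2, Op.eval]
  rw [e4]
  refine .exec b4 h4 ?_
  have e5 : (Instr.op .add 0 0 2).exec s4 = s5 := by
    have := r4.base
    simp [Instr.exec, hs5, Op.eval, this]
    simp [hs4]
  rw [e5]
  exact .refl b5

theorem Prim.reaches {E : Env} (hE : 32 < E.bound) {p : Program} (q : Prim) {o : ℕ} {V : Store}
    {s : State} (hok : q.Ok E V) (hc : CodeAt p o q.code) (hpc : s.pc = o) (hR : Rep E V s)
    (hs : s.Bounded E.bound) :
    ∃ s', Reaches p E.bound 6 s s' ∧ s'.pc = o + 6 ∧ Rep E (q.eval E V) s' := by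
  subst hpc
  cases q with
  | const d k =>
    obtain ⟨s', h1, h2, h3⟩ := reaches_pad hE 5 (s := (Instr.const (d + 3) k).exec s) hc.2 rfl
      (hR.assign _ d k) (hs.update_reg _ _ hok)
    exact ⟨s', .exec hs hc.1 h1, h2, h3⟩
  | op f d a b =>
    have e : (Instr.op f (d + 3) (a + 3) (b + 3)).exec s = ⟨s.pc + 1,
        Function.update s.reg (d + 3) (f.eval (V.var a) (V.var b)), s.mem⟩ := by
      simp [Instr.exec, hR.var]
    obtain ⟨s', h1, h2, h3⟩ := reaches_pad hE 5
      (s := (Instr.op f (d + 3) (a + 3) (b + 3)).exec s) hc.2 rfl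
      (by rw [e]; exact hR.assign _ d _) (by rw [e]; exact hs.update_reg _ _ hok)
    exact ⟨s', .exec hs hc.1 h1, h2, h3⟩
  | input d a =>
    have e : (Instr.load (d + 3) (a + 3)).exec s = ⟨s.pc + 1,
        Function.update s.reg (d + 3) (E.inp (V.var a)), s.mem⟩ := by
      simp [Instr.exec, hR.var, hR.inp _ hok]
    obtain ⟨s', h1, h2, h3⟩ := reaches_pad hE 5
      (s := (Instr.load (d + 3) (a + 3)).exec s) hc.2 rfl
      (by rw [e]; exact hR.assign _ d _)
      (by rw [e, ← hR.inp _ hok]; exact hs.update_reg _ _ (hs _).2)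
    exact ⟨s', .exec hs hc.1 h1, h2, h3⟩
  | load z d a =>
    obtain ⟨s', h1, h2, h3, h4, h5⟩ := reaches_address hE hok.1 hok.2 hc rfl hR hs
    have e : (Instr.load (d + 3) 0).exec s' = ⟨s'.pc + 1,
        Function.update s'.reg (d + 3) (V.arr z (V.var a)), s'.mem⟩ := by
      simp [Instr.exec, h4, h3.arr z hok.1]
    refine ⟨_, h1.trans (.exec h1.bounded_end h5 (.refl ?_)), ?_, ?_⟩
    · rw [e, ← h3.arr z hok.1]; exact h1.bounded_end.update_reg _ _ (h1.bounded_end _).2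
    · rw [e]; simp [h2]
    · rw [e]; exact h3.assign _ _ _
  | store z a b =>
    obtain ⟨s', h1, h2, h3, h4, h5⟩ := reaches_address hE hok.1 hok.2 hc rfl hR hs
    have e : (Instr.store 0 (b + 3)).exec s' = ⟨s'.pc + 1, s'.reg,
        Function.update s'.mem (V.var a * 32 + z + E.base) (V.var b)⟩ := by
      simp [Instr.exec, h4, h3.var]
    refine ⟨_, h1.trans (.exec h1.bounded_end h5 (.refl ?_)), ?_, ?_⟩
    · rw [e]; exact h1.bounded_end.update_mem _ _ (by rw [← h3.var]; exact (h1.bounded_end _).1)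
    · rw [e]; simp [h2]
    · rw [e]; exact h3.set _ hok.1 _ _

/-- The variable that stands for register `r` in the simulation number `z`. -/
def bank (z r : ℕ) : ℕ := 32 + (r * 16 + z)

/-- The translation of one instruction of a program with `len` instructions that is simulated in
the array `z` by code starting at position `o`. -/
def simInstr (z o len : ℕ) : Instr → List Instr
  | .const d k => (Prim.const (bank z d) k).code
  | .op f d a b => (Prim.op f (bank z d) (bank z a) (bank z b)).code
  | .load d a => (Prim.load z (bank z d) (bank z a)).code
  | .store a b => (Prim.store z (bank z a) (bank z b)).code
  | .jump l => [.jump (o + 6 * min l len), pad, pad, pad, pad, pad]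
  | .jumpZero a l => [.jumpZero (bank z a + 3) (o + 6 * min l len), pad, pad, pad, pad, pad]

theorem length_simInstr (z o len : ℕ) (i : Instr) : (simInstr z o len i).length = 6 := by
  cases i <;> rfl

/-- The structured language. -/
inductive Com where
  /-- elementary commands, one after the other -/
  | block (l : List Prim)
  /-- sequential composition -/
  | seq (c c' : Com)
  /-- repeat `c` while `v[r]` is not `0` -/
  | loop (r : ℕ) (c : Com)
  /-- simulate a program with array `z` as its memory -/
  | call (p : Program) (z : ℕ)

/-- The number of instructions of the translation of a command. -/
def Com.size : Com → ℕ
  | .block l => 6 * l.length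
  | .seq c c' => c.size + c'.size
  | .loop _ c => c.size + 2
  | .call p _ => 6 * p.length

/-- The translation of a command, to be placed at position `o`. -/
def Com.code : Com → ℕ → List Instr
  | .block l, _ => l.flatMap Prim.code
  | .seq c c', o => c.code o ++ c'.code (o + c.size)
  | .loop r c, o => .jumpZero (r + 3) (o + (c.size + 2)) :: (c.code (o + 1) ++ [.jump o])
  | .call p z, o => p.flatMap (simInstr z o p.length)

theorem length_flatMap_six {α : Type*} (f : α → List Instr) (hf : ∀ a, (f a).length = 6)
    (l : List α) : (l.flatMap f).length = 6 * l.length := by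
  induction l with
  | nil => rfl
  | cons a l ih => simp [hf, ih]; ring

theorem Com.length_code (c : Com) (o : ℕ) : (c.code o).length = c.size := by
  induction c generalizing o with
  | block l => exact length_flatMap_six _ Prim.length_code l
  | seq c c' h h' => simp [Com.code, Com.size, h, h']
  | loop r c h => simp [Com.code, Com.size, h]
  | call p z => exact length_flatMap_six _ (length_simInstr _ _ _) p

/-- `c.Wp E T Q V`: started in the store `V`, the command `c` ends, after at most `T` steps of its
translation and with all words within the bound, in a store with property `Q`. -/
def Com.Wp (E : Env) (c : Com) (T : ℕ) (Q : Store → Prop) (V : Store) : Prop :=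
  ∀ (p : Program) (o : ℕ), CodeAt p o (c.code o) → ∀ s : State, s.pc = o → Rep E V s →
    s.Bounded E.bound → ∃ t ≤ T, ∃ s' V', Reaches p E.bound t s s' ∧ s'.pc = o + c.size ∧
      Rep E V' s' ∧ Q V'

theorem Com.Wp.mono {E : Env} {c : Com} {T T' : ℕ} {Q Q' : Store → Prop} {V : Store}
    (h : c.Wp E T Q V) (hT : T ≤ T') (hQ : ∀ V', Q V' → Q' V') : c.Wp E T' Q' V := by
  intro p o hc s hpc hR hs
  obtain ⟨t, ht, s', V', h1, h2, h3, h4⟩ := h p o hc s hpc hR hs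
  exact ⟨t, ht.trans hT, s', V', h1, h2, h3, hQ _ h4⟩

theorem Com.Wp.seq {E : Env} {c c' : Com} {T T' : ℕ} {Q Q' : Store → Prop} {V : Store}
    (h : c.Wp E T Q V) (h' : ∀ V', Q V' → c'.Wp E T' Q' V') :
    (Com.seq c c').Wp E (T + T') Q' V := by
  intro p o hc s hpc hR hs
  rw [Com.code, codeAt_append, Com.length_code] at hc
  obtain ⟨t, ht, s', V', h1, h2, h3, h4⟩ := h p o hc.1 s hpc hR hs
  obtain ⟨t', ht', s'', V'', h1', h2', h3', h4'⟩ :=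
    h' V' h4 p _ hc.2 s' h2 h3 h1.bounded_end
  exact ⟨t + t', by omega, s'', V'', h1.trans h1', by rw [h2', Com.size, Nat.add_assoc], h3', h4'⟩

/-- The effect of a list of elementary commands. -/
def evalBlock (E : Env) : List Prim → Store → Store
  | [], V => V
  | q :: l, V => evalBlock E l (q.eval E V)

/-- All commands of the list can be executed, one after the other. -/
def OkBlock (E : Env) : List Prim → Store → Prop
  | [], _ => True
  | q :: l, V => q.Ok E V ∧ OkBlock E l (q.eval E V)

theorem evalBlock_append {E : Env} (l l' : List Prim) (V : Store) :
    evalBlock E (l ++ l') V = evalBlock E l' (evalBlock E l V) := by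
  induction l generalizing V with
  | nil => rfl
  | cons q l ih => exact ih _

theorem okBlock_append {E : Env} (l l' : List Prim) (V : Store) :
    OkBlock E (l ++ l') V ↔ OkBlock E l V ∧ OkBlock E l' (evalBlock E l V) := by
  induction l generalizing V with
  | nil => simp [OkBlock, evalBlock]
  | cons q l ih => simp [OkBlock, evalBlock, ih, and_assoc]

/-- The rule for a block: it takes six steps for each elementary command. -/
theorem Com.wp_block {E : Env} (hE : 32 < E.bound) {l : List Prim} {Q : Store → Prop} {V : Store}
    (hok : OkBlock E l V) (hQ : Q (evalBlock E l V)) :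
    (Com.block l).Wp E (6 * l.length) Q V := by
  intro p o hc s hpc hR hs
  refine ⟨_, le_rfl, ?_⟩
  simp only [Com.code, Com.size] at hc ⊢
  induction l generalizing V o s with
  | nil => exact ⟨s, V, .refl hs, hpc, hR, hQ⟩
  | cons q l ih =>
    rw [List.flatMap_cons, codeAt_append, Prim.length_code] at hc
    obtain ⟨s1, h1, h2, h3⟩ := q.reaches hE hok.1 hc.1 hpc hR hs
    obtain ⟨s', V', h1', h2', h3', h4'⟩ := ih hok.2 hQ (o + 6) hc.2 s1 h2 h3 h1.bounded_end
    refine ⟨s', V', ?_, ?_, h3', h4'⟩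
    · have := h1.trans h1'
      rwa [List.length_cons, Nat.mul_add, Nat.add_comm, Nat.mul_one]
    · rw [h2', List.length_cons]; ring

/-- A loop with `n` rounds and the invariant `I j` before round `j`. -/
theorem Com.wp_loop {E : Env} {r : ℕ} {c : Com} {T n : ℕ} (I : ℕ → Store → Prop)
    (hbody : ∀ j < n, ∀ V, I j V → V.var r ≠ 0 ∧ c.Wp E T (I (j + 1)) V)
    (hend : ∀ V, I n V → V.var r = 0) {V : Store} (h0 : I 0 V) :
    (Com.loop r c).Wp E (n * (T + 2) + 1) (I n) V := by
  suffices H : ∀ k j, j + k = n → ∀ V, I j V → (Com.loop r c).Wp E (k * (T + 2) + 1) (I n) V from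
    H n 0 (by omega) V h0
  intro k
  induction k with
  | zero =>
    intro j hj V hV p o hc s hpc hR hs
    obtain rfl : j = n := by omega
    have hr : s.reg (r + 3) = 0 := by rw [hR.var, hend V hV]
    refine ⟨1, by omega, (Instr.jumpZero (r + 3) (o + (c.size + 2))).exec s, V,
      .exec hs (by rw [hpc]; exact hc.1) (.refl hs), by simp [Instr.exec, hr, Com.size],
      ⟨hR.base, hR.var, hR.inp, hR.arr⟩, hV⟩
  | succ k ih =>
    intro j hj V hV p o hc s hpc hR hs
    have hc0 := hc
    obtain ⟨hr, hW⟩ := hbody j (by omega) V hV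
    rw [← hR.var] at hr
    obtain ⟨hc1, hc2⟩ := hc
    rw [codeAt_append, Com.length_code] at hc2
    set s1 := (Instr.jumpZero (r + 3) (o + (c.size + 2))).exec s with hs1
    obtain ⟨t, ht, s2, V', h1, h2, h3, h4⟩ := hW p (o + 1) hc2.1 s1
      (by simp [hs1, Instr.exec, hr, hpc]) ⟨hR.base, hR.var, hR.inp, hR.arr⟩ hs
    obtain ⟨t', ht', s', V'', h1', h2', h3', h4'⟩ := ih (j + 1) (by omega) V' h4 p o hc0
      ((Instr.jump o).exec s2) rfl ⟨h3.base, h3.var, h3.inp, h3.arr⟩ h1.bounded_end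
    refine ⟨(t + (t' + 1)) + 1, ?_, s', V'', ?_, h2', h3', h4'⟩
    · rw [Nat.add_mul]; omega
    · exact .exec hs (by rw [hpc]; exact hc1)
        (h1.trans (.exec h1.bounded_end (by rw [h2]; exact hc2.2.1) h1'))

/-! ### Simulating a program inside an array -/

/-- The store `V` represents, in the array `z` and the variables `bank z r`, the registers and the
memory of the configuration `s`, and it agrees with `V₀` elsewhere. -/
structure Simulates (z : ℕ) (V₀ V : Store) (s : State) : Prop where
  reg : ∀ r, V.var (bank z r) = s.reg r
  mem : ∀ i, V.arr z i = s.mem i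
  frame_var : ∀ a, (∀ r, a ≠ bank z r) → V.var a = V₀.var a
  frame_arr : ∀ z', z' ≠ z → V.arr z' = V₀.arr z'

theorem bank_injective (z : ℕ) : Function.Injective (bank z) := by
  intro r r' h; unfold bank at h; omega

theorem Simulates.assign {z : ℕ} {V₀ V : Store} {s : State} (h : Simulates z V₀ V s)
    (pc d v : ℕ) :
    Simulates z V₀ (V.assign (bank z d) v) ⟨pc, Function.update s.reg d v, s.mem⟩ := by
  refine ⟨fun r => ?_, h.mem, fun a ha => ?_, h.frame_arr⟩
  · by_cases hr : r = d
    · subst hr; simp [Store.assign]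
    · simpa [Store.assign, Function.update_of_ne hr,
        Function.update_of_ne ((bank_injective z).ne hr)] using h.reg r
  · simpa [Store.assign, Function.update_of_ne (ha d)] using h.frame_var a ha

theorem Simulates.set {z : ℕ} {V₀ V : Store} {s : State} (h : Simulates z V₀ V s)
    (pc i v : ℕ) :
    Simulates z V₀ (V.set z i v) ⟨pc, s.reg, Function.update s.mem i v⟩ := by
  refine ⟨h.reg, fun r => ?_, h.frame_var, fun z' hz' => ?_⟩
  · by_cases hr : r = i
    · subst hr; simp [Store.set]
    · simpa [Store.set, Function.update_of_ne hr] using h.mem r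
  · simpa [Store.set, Function.update_of_ne hz'] using h.frame_arr z' hz'

theorem codeAt_flatMap_six {α : Type*} {p : Program} (f : α → List Instr)
    (hf : ∀ a, (f a).length = 6) (l : List α) (o k : ℕ) {a : α} (hk : l[k]? = some a)
    (hc : CodeAt p o (l.flatMap f)) : CodeAt p (o + 6 * k) (f a) := by
  induction l generalizing o k with
  | nil => simp at hk
  | cons b l ih =>
    rw [List.flatMap_cons, codeAt_append, hf] at hc
    cases k with
    | zero =>
      simp only [List.length_cons, Nat.zero_lt_succ, getElem?_pos, List.getElem_cons_zero,
        Option.some.injEq] at hk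
      subst hk; simpa using hc.1
    | succ k =>
      have := ih (o + 6) k (by simpa using hk) hc.2
      rwa [show o + 6 * (k + 1) = o + 6 + 6 * k by ring]

/-- One step of the simulated program takes at most six steps. -/
theorem simulates_step {E : Env} (hE : 32 < E.bound) {q p : Program} {z o b : ℕ} (hz : z < 32)
    (hb : b * 32 + 32 + E.base ≤ E.bound) (hc : CodeAt p o ((Com.call q z).code o)) {V₀ V : Store}
    {s σ : State} (hσ : ¬ Halted q σ) (hσb : σ.Bounded b) (hσb' : (step q σ).Bounded b)
    (hsim : Simulates z V₀ V σ) (hpc : s.pc = o + 6 * min σ.pc q.length) (hR : Rep E V s)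
    (hs : s.Bounded E.bound) :
    ∃ t ≤ 6, ∃ s' V', Reaches p E.bound t s s' ∧
      s'.pc = o + 6 * min (step q σ).pc q.length ∧ Rep E V' s' ∧
      Simulates z V₀ V' (step q σ) := by
  have hlt : σ.pc < q.length := by simpa [Halted] using hσ
  rw [min_eq_left hlt.le] at hpc
  obtain ⟨i, hi⟩ : ∃ i, q[σ.pc]? = some i := ⟨_, List.getElem?_eq_getElem hlt⟩
  have hst : step q σ = i.exec σ := by simp [step, hi]
  rw [hst] at hσb' ⊢
  have hcode := codeAt_flatMap_six _ (length_simInstr z o q.length) q o σ.pc hi hc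
  have prim : ∀ r : Prim, simInstr z o q.length i = r.code → r.Ok E V →
      (i.exec σ).pc = σ.pc + 1 → Simulates z V₀ (r.eval E V) (i.exec σ) →
      ∃ t ≤ 6, ∃ s' V', Reaches p E.bound t s s' ∧
        s'.pc = o + 6 * min (i.exec σ).pc q.length ∧ Rep E V' s' ∧
        Simulates z V₀ V' (i.exec σ) := by
    intro r h1 h2 h3 h4
    rw [h1] at hcode
    obtain ⟨s', g1, g2, g3⟩ := r.reaches hE h2 hcode hpc hR hs
    refine ⟨6, le_rfl, s', _, g1, ?_, g3, h4⟩
    rw [g2, h3, min_eq_left (by omega : σ.pc + 1 ≤ q.length)]; ring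
  cases i with
  | const d k =>
    refine prim (.const (bank z d) k) rfl ?_ rfl (hsim.assign _ d k)
    have := (hσb' d).1
    simp only [Instr.exec, Function.update_self] at this
    change k < E.bound
    omega
  | op f d a c =>
    refine prim (.op f (bank z d) (bank z a) (bank z c)) rfl ?_ rfl ?_
    · have := (hσb' d).1
      simp only [Instr.exec, Function.update_self] at this
      simp only [Prim.Ok, hsim.reg]
      omega
    · simp only [Prim.eval, hsim.reg]; exact hsim.assign _ d _
  | load d a =>
    refine prim (.load z (bank z d) (bank z a)) rfl ⟨hz, ?_⟩ rfl ?_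
    · have := (hσb a).1
      rw [hsim.reg]; omega
    · simp only [Prim.eval, hsim.reg, hsim.mem]; exact hsim.assign _ d _
  | store a c =>
    refine prim (.store z (bank z a) (bank z c)) rfl ⟨hz, ?_⟩ rfl ?_
    · have := (hσb a).1
      rw [hsim.reg]; omega
    · simp only [Prim.eval, hsim.reg]; exact hsim.set _ _ _
  | jump l =>
    exact ⟨1, by norm_num, (Instr.jump (o + 6 * min l q.length)).exec s, V,
      .exec hs (by rw [hpc]; exact hcode.1) (.refl hs), rfl, ⟨hR.base, hR.var, hR.inp, hR.arr⟩,
      ⟨hsim.reg, hsim.mem, hsim.frame_var, hsim.frame_arr⟩⟩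
  | jumpZero a l =>
    have ha : s.reg (bank z a + 3) = σ.reg a := by rw [hR.var, hsim.reg]
    set s1 := (Instr.jumpZero (bank z a + 3) (o + 6 * min l q.length)).exec s with hs1
    have hR1 : Rep E V s1 := ⟨hR.base, hR.var, hR.inp, hR.arr⟩
    by_cases h0 : σ.reg a = 0
    · refine ⟨1, by norm_num, s1, V, .exec hs (by rw [hpc]; exact hcode.1) (.refl hs), ?_, hR1,
        ⟨hsim.reg, hsim.mem, hsim.frame_var, hsim.frame_arr⟩⟩
      simp [hs1, Instr.exec, ha, h0]
    · obtain ⟨s', g1, g2, g3⟩ := reaches_pad hE 5 (s := s1) hcode.2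
        (by simp [hs1, Instr.exec, ha, h0, hpc]) hR1 hs
      refine ⟨6, le_rfl, s', V, .exec hs (by rw [hpc]; exact hcode.1) g1, ?_, g3,
        ⟨hsim.reg, hsim.mem, hsim.frame_var, hsim.frame_arr⟩⟩
      rw [g2]
      simp only [Instr.exec, h0, if_false]
      rw [min_eq_left (by omega : σ.pc + 1 ≤ q.length)]; ring

/-- A call runs the program `q` on the input that stands in the array `z`, provided that the
variables `bank z r` are `0`. -/
theorem Com.wp_call {E : Env} (hE : 32 < E.bound) {q : Program} {z b T : ℕ} (hz : z < 32)
    (hb : b * 32 + 32 + E.base ≤ E.bound) {input : List ℕ} {V : Store}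
    (hreg : ∀ r, V.var (bank z r) = 0) (hmem : ∀ i, V.arr z i = input.getD i 0)
    (hbd : ∀ t, (run q input t).Bounded b) (hhalt : Halted q (run q input T)) :
    (Com.call q z).Wp E (6 * T) (fun V' => Simulates z V V' (run q input T)) V := by
  classical
  intro p o hc s hpc hR hs
  have hex : ∃ t, Halted q (run q input t) := ⟨T, hhalt⟩
  have hrun : ∀ t, run q input (t + 1) = step q (run q input t) := fun t =>
    Function.iterate_succ_apply' _ _ _
  have key : ∀ t ≤ Nat.find hex, ∃ t' ≤ 6 * t, ∃ s' V', Reaches p E.bound t' s s' ∧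
      s'.pc = o + 6 * min (run q input t).pc q.length ∧ Rep E V' s' ∧
      Simulates z V V' (run q input t) := by
    intro t
    induction t with
    | zero =>
      intro _
      exact ⟨0, le_rfl, s, V, .refl hs, by simp [run, init, hpc], hR,
        ⟨hreg, hmem, fun _ _ => rfl, fun _ _ => rfl⟩⟩
    | succ t ih =>
      intro ht
      obtain ⟨t1, ht1, s1, V1, h1, h2, h3, h4⟩ := ih (by omega)
      obtain ⟨t2, ht2, s2, V2, h1', h2', h3', h4'⟩ := simulates_step hE hz hb hc
        (Nat.find_min hex (by omega)) (hbd t) (by rw [← hrun]; exact hbd _) h4 h2 h3 h1.bounded_end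
      rw [← hrun] at h2' h4'
      exact ⟨t1 + t2, by omega, s2, V2, h1.trans h1', h2', h3', h4'⟩
  obtain ⟨t, ht, s', V', h1, h2, h3, h4⟩ := key _ le_rfl
  have hle : Nat.find hex ≤ T := Nat.find_min' hex hhalt
  have hfin : run q input T = run q input (Nat.find hex) := by
    obtain ⟨k, hk⟩ := Nat.exists_eq_add_of_le' hle
    rw [run, hk, Function.iterate_add_apply]
    exact iterate_step_of_halted (Nat.find_spec hex) k
  refine ⟨t, by omega, s', V', h1, ?_, h3, by rw [hfin]; exact h4⟩
  rw [h2, min_eq_right (Nat.find_spec hex)]; rfl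

end WordRAM

/-! ### Arranging the edges in groups -/

namespace Grouping

variable (w : ℕ → ℕ) (L : ℕ)

/-- The number of items `i < L` in the group `u`, where item `i` belongs to the group `w i`. -/
def deg (u : ℕ) : ℕ := ((Finset.range L).filter fun i => w i = u).card

/-- The first item of a group. -/
noncomputable def first (u : ℕ) : ℕ := sInf {i | w i = u}

/-- The total size of the groups that appear among the items below `t`. -/
noncomputable def before (t : ℕ) : ℕ := ((Finset.range L).filter fun i => first w (w i) < t).card

/-- The total size of the groups that appear before the group `u`. -/
noncomputable def start (u : ℕ) : ℕ := before w L (first w u)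

/-- The number of items below `j` of the group `u`. -/
def fill (u j : ℕ) : ℕ := ((Finset.range j).filter fun i => w i = u).card

/-- The rank of item `j` when the groups are arranged in the order of their first items. -/
noncomputable def slot (j : ℕ) : ℕ := start w L (w j) + fill w (w j) j

variable {w L}

theorem first_spec (j : ℕ) : w (first w (w j)) = w j :=
  Nat.sInf_mem (s := {i | w i = w j}) ⟨j, rfl⟩

theorem first_le (j : ℕ) : first w (w j) ≤ j := Nat.sInf_le (s := {i | w i = w j}) rfl

theorem first_inj {i j : ℕ} (h : first w (w i) = first w (w j)) : w i = w j := by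
  have hi := first_spec (w := w) i
  rw [h, first_spec (w := w) j] at hi
  exact hi.symm

theorem fill_lt_deg {j : ℕ} (hj : j < L) : fill w (w j) j < deg w L (w j) := by
  refine Finset.card_lt_card ⟨fun i hi => ?_, fun h => ?_⟩
  · simp only [Finset.mem_filter, Finset.mem_range] at hi ⊢
    exact ⟨hi.1.trans hj, hi.2⟩
  · have := @h j (by simp [hj])
    simp at this

theorem fill_lt_fill {i j : ℕ} (hij : i < j) (h : w i = w j) :
    fill w (w i) i < fill w (w j) j := by
  rw [← h]
  refine Finset.card_lt_card ⟨fun i' hi => ?_, fun h' => ?_⟩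
  · simp only [Finset.mem_filter, Finset.mem_range] at hi ⊢
    exact ⟨hi.1.trans hij, hi.2⟩
  · have := @h' i (by simp [hij])
    simp at this

theorem before_add_deg (u : ℕ) :
    before w L (first w u) + deg w L u =
      ((Finset.range L).filter fun i => first w (w i) < first w u ∨ w i = u).card := by
  rw [Finset.filter_or, Finset.card_union_of_disjoint]
  · rfl
  · rw [Finset.disjoint_filter]
    rintro i - h rfl
    exact lt_irrefl _ h

theorem start_add_deg_le {u v : ℕ} (h : first w u < first w v) :
    start w L u + deg w L u ≤ start w L v := by
  rw [start, before_add_deg]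
  rw [start, before]
  refine Finset.card_le_card fun i hi => ?_
  simp only [Finset.mem_filter] at hi ⊢
  refine ⟨hi.1, ?_⟩
  rcases hi.2 with h' | rfl
  · exact h'.trans h
  · exact h

theorem start_add_deg_le_length (u : ℕ) : start w L u + deg w L u ≤ L := by
  rw [start, before_add_deg]
  simpa using Finset.card_filter_le (Finset.range L)
    (fun i => first w (w i) < first w u ∨ w i = u)

/-! ### Placing four copies of every edge on a line -/

/-- Whether, in a group, the copies of class `k` come after those of the other class of the same
half. The classes `0, 1` form the first half and `2, 3` the second; `a` and `b` say for each half
whether the odd class comes first. -/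
def lag (a b : Bool) (k : Fin 4) : Bool :=
  xor (decide (k = 1 ∨ k = 3)) (if k < 2 then a else b)

/-- The position of the copy of class `k` of item `j`. The groups appear in the same order in both
halves; in each half, a group consists of all copies of one class and then all copies of the
other one. -/
noncomputable def pos (w : ℕ → ℕ) (L : ℕ) (a b : Bool) (k : Fin 4) (j : ℕ) : ℕ :=
  (if k < 2 then 0 else 2 * L) + (start w L (w j) + slot w L j) +
    (if lag a b k then deg w L (w j) else 0)

theorem eq_of_lag_eq : ∀ (a b : Bool) (k k' : Fin 4), (k < 2 ↔ k' < 2) →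
    lag a b k = lag a b k' → k = k' := by decide

/-- The order of the copies: first by half, then by group, then by class as the ties in this half
are broken, and finally by item. -/
theorem pos_lt_iff {a b : Bool} {k k' : Fin 4} {i j : ℕ} (hi : i < L) (hj : j < L) :
    pos w L a b k i < pos w L a b k' j ↔ (k < 2 ∧ ¬ k' < 2) ∨ ((k < 2 ↔ k' < 2) ∧
      (first w (w i) < first w (w j) ∨ (w i = w j ∧
        ((k = k' ∧ i < j) ∨ (lag a b k = false ∧ lag a b k' = true))))) := by
  have h1 := fill_lt_deg (w := w) hi
  have h2 := fill_lt_deg (w := w) hj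
  have h3 := start_add_deg_le_length (w := w) (L := L) (w i)
  have h4 := start_add_deg_le_length (w := w) (L := L) (w j)
  have h5 : (if lag a b k then deg w L (w i) else 0) ≤ deg w L (w i) := by split_ifs <;> omega
  have h6 : (if lag a b k' then deg w L (w j) else 0) ≤ deg w L (w j) := by split_ifs <;> omega
  by_cases hkk : k < 2 ↔ k' < 2
  · have hhalf : (if k < 2 then 0 else 2 * L) = if k' < 2 then 0 else 2 * L := by simp only [hkk]
    have hne : ¬ (k < 2 ∧ ¬ k' < 2) := fun h => h.2 (hkk.1 h.1)
    rw [or_iff_right hne, and_iff_right hkk, pos, pos, slot, slot, hhalf]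
    generalize (if k' < 2 then 0 else 2 * L) = half
    rcases lt_trichotomy (first w (w i)) (first w (w j)) with h | h | h
    · have := start_add_deg_le (L := L) h
      simp only [h, true_or, iff_true]
      omega
    · have hw := first_inj h
      rw [hw] at h1 h5 ⊢
      simp only [lt_irrefl, true_and, false_or]
      by_cases hkk' : k = k'
      · subst hkk'
        simp only [true_and]
        have h7 : ¬ (lag a b k = false ∧ lag a b k = true) := by simp
        simp only [h7, or_false]
        rcases lt_trichotomy i j with hij | hij | hij
        · have := fill_lt_fill hij hw
          rw [hw] at this
          simp only [hij, iff_true]; omega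
        · subst hij; simp
        · have := fill_lt_fill hij hw.symm
          rw [hw] at this
          simp only [hij.not_gt, iff_false]; omega
      · have hl : lag a b k ≠ lag a b k' := fun h => hkk' (eq_of_lag_eq a b k k' hkk h)
        simp only [hkk', false_and, false_or]
        cases hlk : lag a b k <;> cases hlk' : lag a b k' <;> simp_all <;> omega
    · have := start_add_deg_le (L := L) h
      have hw : w i ≠ w j := by intro hw; rw [hw] at h; exact lt_irrefl _ h
      simp only [h.not_gt, hw, false_and, or_false, iff_false]
      omega
  · by_cases hk : k < 2
    · have hk' : ¬ k' < 2 := fun h => hkk ⟨fun _ => h, fun _ => hk⟩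
      simp only [pos, slot, hk, hk', if_true, if_false, not_false_eq_true, and_self, true_or,
        iff_true]
      omega
    · have hk' : k' < 2 := by
        by_contra h
        exact hkk ⟨fun h' => absurd h' hk, fun h' => absurd h' h⟩
      simp only [pos, slot, hk, hk', if_true, if_false, false_and, or_self, iff_true, iff_false]
      omega

theorem pos_lt {a b : Bool} {k : Fin 4} {j : ℕ} (hj : j < L) : pos w L a b k j < 4 * L := by
  have h1 := fill_lt_deg (w := w) hj
  have h2 := start_add_deg_le_length (w := w) (L := L) (w j)
  unfold pos slot
  split_ifs <;> omega

theorem pos_injective (a b : Bool) : Function.Injective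
    fun p : Fin 4 × Fin L => (⟨pos w L a b p.1 p.2, pos_lt p.2.2⟩ : Fin (4 * L)) := by
  rintro ⟨k, i⟩ ⟨k', j⟩ h
  simp only [Fin.mk.injEq] at h
  have h1 := (pos_lt_iff (a := a) (b := b) (k := k) (k' := k') (w := w) i.2 j.2).not.1 h.not_lt
  have h2 := (pos_lt_iff (a := a) (b := b) (k := k') (k' := k) (w := w) j.2 i.2).not.1 h.not_gt
  push Not at h1 h2
  have hk : k < 2 ↔ k' < 2 := ⟨fun hk => h1.1 hk, fun hk => h2.1 hk⟩
  have h1 := h1.2 hk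
  have h2 := h2.2 hk.symm
  have hw : w i = w j := first_inj (le_antisymm h2.1 h1.1)
  have h1 := h1.2 hw
  have h2 := h2.2 hw.symm
  have hl : lag a b k = lag a b k' := by
    cases hx : lag a b k <;> cases hy : lag a b k' <;> simp_all
  obtain rfl := eq_of_lag_eq a b k k' hk hl
  have : i = j := Fin.ext (le_antisymm (h2.1 rfl) (h1.1 rfl))
  rw [this]

variable (w L) in
/-- The arrangement of the four copies of all items on a line. -/
noncomputable def posEquiv (a b : Bool) : Fin 4 × Fin L ≃ Fin (4 * L) :=
  Equiv.ofBijective _ ((Fintype.bijective_iff_injective_and_card _).2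
    ⟨pos_injective (w := w) a b, by simp⟩)

theorem posEquiv_lt_iff (a b : Bool) (p q : Fin 4 × Fin L) :
    posEquiv w L a b p < posEquiv w L a b q ↔ (p.1 < 2 ∧ ¬ q.1 < 2) ∨ ((p.1 < 2 ↔ q.1 < 2) ∧
      (first w (w p.2) < first w (w q.2) ∨ (w p.2 = w q.2 ∧
        ((p.1 = q.1 ∧ (p.2 : ℕ) < q.2) ∨ (lag a b p.1 = false ∧ lag a b q.1 = true))))) :=
  pos_lt_iff p.2.2 q.2.2

/-! ### The alternating sum over the ways to break ties -/

variable (w) in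
/-- The four points appear in this order on the line. -/
def Ordered (a b : Bool) (h : Fin 4 → Fin 4 × Fin L) : Prop :=
  StrictMono fun i => posEquiv w L a b (h i)

open Classical in
variable (w) in
/-- The alternating sum, over the ways to break the ties in the two halves, of the indicator of
the event that the four points appear in this order. -/
noncomputable def altSum (h : Fin 4 → Fin 4 × Fin L) : ℤ :=
  ((if Ordered w false false h then 1 else 0) - (if Ordered w true false h then 1 else 0)) -
  ((if Ordered w false true h then 1 else 0) - (if Ordered w true true h then 1 else 0))

/-- Flipping the ties in a half matters only for two points of different classes of this half;
this is the statement for the first half, where the class `k` is missing. -/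
theorem lag_congr_left : ∀ (a a' b : Bool) (k k₁ k₂ : Fin 4), k < 2 → k₁ ≠ k → k₂ ≠ k →
    (k₁ < 2 ↔ k₂ < 2) →
    (lag a b k₁ = false ∧ lag a b k₂ = true ↔ lag a' b k₁ = false ∧ lag a' b k₂ = true) := by
  decide

theorem lag_congr_right : ∀ (a b b' : Bool) (k k₁ k₂ : Fin 4), ¬ k < 2 → k₁ ≠ k → k₂ ≠ k →
    (k₁ < 2 ↔ k₂ < 2) →
    (lag a b k₁ = false ∧ lag a b k₂ = true ↔ lag a b' k₁ = false ∧ lag a b' k₂ = true) := by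
  decide

theorem ordered_congr {a b a' b' : Bool} {h : Fin 4 → Fin 4 × Fin L}
    (H : ∀ i i', ((h i).1 < 2 ↔ (h i').1 < 2) →
      (lag a b (h i).1 = false ∧ lag a b (h i').1 = true ↔
        lag a' b' (h i).1 = false ∧ lag a' b' (h i').1 = true)) :
    Ordered w a b h ↔ Ordered w a' b' h := by
  refine forall_congr' fun i => forall_congr' fun i' => imp_congr_right fun _ => ?_
  simp only [posEquiv_lt_iff]
  by_cases hh : (h i).1 < 2 ↔ (h i').1 < 2
  · rw [H i i' hh]
  · simp only [hh, false_and]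

/-- If one of the four classes is missing, flipping the ties in its half changes nothing, so that
the alternating sum vanishes. -/
theorem exists_of_altSum_ne_zero {h : Fin 4 → Fin 4 × Fin L} (h0 : altSum w h ≠ 0) (k : Fin 4) :
    ∃ i, (h i).1 = k := by
  classical
  by_contra! hk
  apply h0
  by_cases hk2 : k < 2
  · have H : ∀ b, (Ordered w false b h ↔ Ordered w true b h) := fun b => ordered_congr
      fun i i' hh => lag_congr_left _ _ _ k _ _ hk2 (hk i) (hk i') hh
    rw [altSum, if_congr (H false) rfl rfl, if_congr (H true) rfl rfl]; ring
  · have H : ∀ a, (Ordered w a false h ↔ Ordered w a true h) := fun a => ordered_congr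
      fun i i' hh => lag_congr_right _ _ _ k _ _ hk2 (hk i) (hk i') hh
    rw [altSum, if_congr (H false) rfl rfl, if_congr (H true) rfl rfl]; ring

theorem halves_of_surjective : ∀ c₀ c₁ c₂ c₃ : Fin 4,
    (∀ k, ∃ i, ![c₀, c₁, c₂, c₃] i = k) →
    (∀ i i', i < i' → ![c₀, c₁, c₂, c₃] i' < 2 → ![c₀, c₁, c₂, c₃] i < 2) →
    ∀ i, ![c₀, c₁, c₂, c₃] i < 2 ↔ i < 2 := by decide

/-- If the alternating sum is not zero, all four classes occur, and the classes of the first half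
come first. -/
theorem lt_two_iff_of_altSum_ne_zero {h : Fin 4 → Fin 4 × Fin L} (h0 : altSum w h ≠ 0)
    (i : Fin 4) : (h i).1 < 2 ↔ i < 2 := by
  have hs := exists_of_altSum_ne_zero h0
  obtain ⟨a, b, hab⟩ : ∃ a b, Ordered w a b h := by
    by_contra! H
    exact h0 (by simp [altSum, H])
  have hm : ∀ i i', i < i' → (h i').1 < 2 → (h i).1 < 2 := by
    intro i i' hii h2
    have := (posEquiv_lt_iff a b _ _).1 (hab hii)
    tauto
  have hv : ![(h 0).1, (h 1).1, (h 2).1, (h 3).1] = fun i => (h i).1 := by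
    ext i; fin_cases i <;> rfl
  have := halves_of_surjective (h 0).1 (h 1).1 (h 2).1 (h 3).1
  rw [hv] at this
  exact this hs hm i

/-- If the four points are of the classes `0, 1, 2, 3`, in this order, then the alternating sum
tests whether the first two and the last two are in the same group. -/
theorem altSum_of_fst_eq {h : Fin 4 → Fin 4 × Fin L} (hid : ∀ i, (h i).1 = i) :
    altSum w h = if w (h 0).2 = w (h 1).2 ∧ w (h 2).2 = w (h 3).2 then 1 else 0 := by
  have key : ∀ a b, Ordered w a b h ↔
      (first w (w (h 0).2) < first w (w (h 1).2) ∨ (w (h 0).2 = w (h 1).2 ∧ a = false)) ∧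
      (first w (w (h 2).2) < first w (w (h 3).2) ∨ (w (h 2).2 = w (h 3).2 ∧ b = false)) := by
    intro a b
    have e1 : posEquiv w L a b (h 0) < posEquiv w L a b (h 1) ↔
        first w (w (h 0).2) < first w (w (h 1).2) ∨ (w (h 0).2 = w (h 1).2 ∧ a = false) := by
      rw [posEquiv_lt_iff]; simp [hid, lag]
    have e2 : posEquiv w L a b (h 1) < posEquiv w L a b (h 2) := by
      rw [posEquiv_lt_iff]; simp [hid]
    have e3 : posEquiv w L a b (h 2) < posEquiv w L a b (h 3) ↔
        first w (w (h 2).2) < first w (w (h 3).2) ∨ (w (h 2).2 = w (h 3).2 ∧ b = false) := by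
      have : ¬ (3 : Fin 4) < 2 := by decide
      rw [posEquiv_lt_iff]; simp [hid, lag, this]
    rw [← e1, ← e3, Ordered, Fin.strictMono_iff_lt_succ]
    constructor
    · exact fun H => ⟨H 0, H 2⟩
    · rintro ⟨H, H'⟩ i
      fin_cases i
      exacts [H, e2, H']
  have h1 : w (h 0).2 = w (h 1).2 → ¬ first w (w (h 0).2) < first w (w (h 1).2) := by
    intro h; rw [h]; exact lt_irrefl _
  have h2 : w (h 2).2 = w (h 3).2 → ¬ first w (w (h 2).2) < first w (w (h 3).2) := by
    intro h; rw [h]; exact lt_irrefl _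
  unfold altSum
  simp only [key]
  by_cases g1 : w (h 0).2 = w (h 1).2 <;> by_cases g2 : w (h 2).2 = w (h 3).2 <;>
    simp [g1, g2]

/-! ### Permutations whose alternating pattern count counts rectangles -/

variable (w) in
/-- The permutation whose points have the positions `pos a b k j` and the heights
`pos c d (σ k) (τ j)`. -/
noncomputable def edgePerm (σ : Equiv.Perm (Fin 4)) (τ : Equiv.Perm (Fin L)) (a b c d : Bool) :
    Equiv.Perm (Fin (4 * L)) :=
  (posEquiv w L a b).symm.trans ((Equiv.prodCongr σ τ).trans (posEquiv w L c d))

/-- The points of `g` in the order of their intended heights, described by the classes and items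
that determine these heights. -/
def byHeight (σ : Equiv.Perm (Fin 4)) (τ : Equiv.Perm (Fin L)) (g : Fin 4 → Fin 4 × Fin L) :
    Fin 4 → Fin 4 × Fin L :=
  fun i => (σ (g (σ.symm i)).1, τ (g (σ.symm i)).2)

/-- Occurrences correspond to quadruples of points that are in the right order from left to right
and, rearranged by the pattern, from bottom to top. -/
theorem patternCount_edgePerm (σ : Equiv.Perm (Fin 4)) (τ : Equiv.Perm (Fin L))
    (a b c d : Bool) : patternCount σ (edgePerm w σ τ a b c d) =
      Nat.card {g : Fin 4 → Fin 4 × Fin L //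
        Ordered w a b g ∧ Ordered w c d (byHeight σ τ g)} := by
  have hoc : ∀ f : Fin 4 ↪o Fin (4 * L), IsOccurrence σ (edgePerm w σ τ a b c d) f ↔
      Ordered w c d (byHeight σ τ fun i => (posEquiv w L a b).symm (f i)) := by
    intro f
    have he : ∀ j, edgePerm w σ τ a b c d (f j) =
        posEquiv w L c d (byHeight σ τ (fun i => (posEquiv w L a b).symm (f i)) (σ j)) := by
      intro j; simp [edgePerm, byHeight, Prod.map]
    constructor
    · intro h i i' hii
      have := (h (σ.symm i) (σ.symm i')).1 (by simpa using hii)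
      rw [he, he] at this
      simpa using this
    · intro h j j'
      rw [he, he]
      exact h.lt_iff_lt.symm
  refine Nat.card_congr
    { toFun := fun f => ⟨fun i => (posEquiv w L a b).symm (f.1 i), ?_, (hoc _).1 f.2⟩
      invFun := fun g => ⟨OrderEmbedding.ofStrictMono _ g.2.1, (hoc _).2 ?_⟩
      left_inv := ?_
      right_inv := ?_ }
  · intro i i' hii
    simpa using f.1.strictMono hii
  · have : (fun i => (posEquiv w L a b).symm (OrderEmbedding.ofStrictMono _ g.2.1 i)) = g.1 :=
      funext fun i => (posEquiv w L a b).symm_apply_apply (g.1 i)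
    rw [this]
    exact g.2.2
  · rintro ⟨f, hf⟩
    ext i
    simp
  · rintro ⟨g, hg⟩
    exact Subtype.ext (funext fun i => (posEquiv w L a b).symm_apply_apply (g i))

/-- The alternating sum of the pattern counts over the 16 ways to break ties. -/
noncomputable def altCount (w : ℕ → ℕ) (σ : Equiv.Perm (Fin 4)) (τ : Equiv.Perm (Fin L)) : ℤ :=
  ∑ a : Bool, ∑ b : Bool, ∑ c : Bool, ∑ d : Bool,
    (-1) ^ (a.toNat + b.toNat + c.toNat + d.toNat) *
      (patternCount σ (edgePerm w σ τ a b c d) : ℤ)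

/-- Horizontal and vertical ties are broken independently, so that the contribution of four points
to the alternating count is a product. -/
theorem altCount_eq_sum (σ : Equiv.Perm (Fin 4)) (τ : Equiv.Perm (Fin L)) :
    altCount w σ τ = ∑ g : Fin 4 → Fin 4 × Fin L, altSum w g * altSum w (byHeight σ τ g) := by
  classical
  have h1 : ∀ a b c d, (patternCount σ (edgePerm w σ τ a b c d) : ℤ) =
      ∑ g : Fin 4 → Fin 4 × Fin L, (if Ordered w a b g then (1 : ℤ) else 0) *
        (if Ordered w c d (byHeight σ τ g) then 1 else 0) := by
    intro a b c d
    rw [patternCount_edgePerm, Nat.card_eq_fintype_card, Fintype.card_subtype,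
      Finset.card_filter]
    push_cast
    exact Finset.sum_congr rfl fun g _ => by
      by_cases h : Ordered w a b g <;> by_cases h' : Ordered w c d (byHeight σ τ g) <;>
        simp [h, h']
  unfold altCount
  simp only [h1, Fintype.sum_bool, Finset.mul_sum, ← Finset.sum_add_distrib]
  refine Finset.sum_congr rfl fun g _ => ?_
  simp only [altSum, Bool.toNat_true, Bool.toNat_false]
  ring

/-- The pattern has only one point in each quadrant: two points whose positions are in the same
half and whose values are in the same half are equal. -/
def Spread (σ : Equiv.Perm (Fin 4)) : Prop :=
  ∀ i i' : Fin 4, (i < 2 ↔ i' < 2) → (σ i < 2 ↔ σ i' < 2) → i = i'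

/-- For a pattern with one point in each quadrant, the alternating count is the number of
quadruples of items that form an aligned rectangle. -/
theorem altCount_eq_card {σ : Equiv.Perm (Fin 4)} (hσ : Spread σ) (τ : Equiv.Perm (Fin L)) :
    altCount w σ τ = (Finset.univ.filter fun e : Fin 4 → Fin L =>
      (w (e 0) = w (e 1) ∧ w (e 2) = w (e 3)) ∧
      (w (τ (e (σ.symm 0))) = w (τ (e (σ.symm 1))) ∧
        w (τ (e (σ.symm 2))) = w (τ (e (σ.symm 3))))).card := by
  rw [altCount_eq_sum, Finset.card_filter]
  push_cast
  symm
  refine Fintype.sum_of_injective (fun (e : Fin 4 → Fin L) i => (i, e i)) ?_ _ _ ?_ ?_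
  · intro e e' h
    ext i
    have := congrFun h i
    simp only [Prod.mk.injEq, true_and] at this
    rw [this]
  · intro g hg
    by_contra h
    obtain ⟨h1, h2⟩ := mul_ne_zero_iff.1 h
    have hid : ∀ i, (g i).1 = i := by
      intro i
      refine hσ _ _ (lt_two_iff_of_altSum_ne_zero h1 i) ?_
      simpa [byHeight] using lt_two_iff_of_altSum_ne_zero h2 (σ i)
    exact hg ⟨fun i => (g i).2, funext fun i => Prod.ext (hid i).symm rfl⟩
  · intro e
    have h2 : altSum w (byHeight σ τ fun i => (i, e i)) =
        if w (τ (e (σ.symm 0))) = w (τ (e (σ.symm 1))) ∧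
          w (τ (e (σ.symm 2))) = w (τ (e (σ.symm 3))) then 1 else 0 :=
      altSum_of_fst_eq (by simp [byHeight])
    rw [altSum_of_fst_eq (fun _ => rfl), h2]
    by_cases hA : w (e 0) = w (e 1) ∧ w (e 2) = w (e 3)
    · by_cases hB : w (τ (e (σ.symm 0))) = w (τ (e (σ.symm 1))) ∧
        w (τ (e (σ.symm 2))) = w (τ (e (σ.symm 3)))
      · rw [if_pos ⟨hA, hB⟩, if_pos hA, if_pos hB, one_mul]
      · rw [if_neg fun h => hB h.2, if_neg hB, mul_zero]
    · rw [if_neg fun h => hA h.1, if_neg hA, zero_mul]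

/-- If all four combinations of `P` and `Q` occur among four indices, then a downward closed
property `P` holds for exactly the first two of them. -/
theorem lt_two_iff_of_quadrants {P Q : Fin 4 → Prop} (hP : ∀ i i', i < i' → P i' → P i)
    (h1 : ∃ i, P i ∧ Q i) (h2 : ∃ i, P i ∧ ¬ Q i) (h3 : ∃ i, ¬ P i ∧ Q i)
    (h4 : ∃ i, ¬ P i ∧ ¬ Q i) (i : Fin 4) : P i ↔ i < 2 := by
  obtain ⟨i₁, p₁, q₁⟩ := h1
  obtain ⟨i₂, p₂, q₂⟩ := h2
  obtain ⟨i₃, p₃, q₃⟩ := h3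
  obtain ⟨i₄, p₄, q₄⟩ := h4
  have lt : ∀ i i', P i → ¬ P i' → i < i' := by
    intro i i' hi hi'
    by_contra h
    rcases (not_lt.1 h).lt_or_eq with h | h
    · exact hi' (hP _ _ h hi)
    · exact hi' (h ▸ hi)
  have h12 : i₁ ≠ i₂ := by rintro rfl; exact q₂ q₁
  have h34 : i₃ ≠ i₄ := by rintro rfl; exact q₄ q₃
  by_cases hi : P i
  · have := lt i i₃ hi p₃
    have := lt i i₄ hi p₄
    simp only [hi, true_iff]
    omega
  · have := lt i₁ i p₁ hi
    have := lt i₂ i p₂ hi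
    simp only [hi, false_iff]
    omega

/-- The two lines that show that a pattern is non-trivial have two points on each side, so they
separate the halves of the positions and of the values. -/
theorem spread_of_isNontrivialPattern {σ : Equiv.Perm (Fin 4)} (hσ : IsNontrivialPattern σ) :
    Spread σ := by
  obtain ⟨n, π, f, v, h, hocc, hne, h1, h2, h3, h4⟩ := hσ
  set P : Fin 4 → Prop := fun j => ((f j : ℕ) : ℝ) < v with hP
  set Q : Fin 4 → Prop := fun j => ((π (f j) : ℕ) : ℝ) < h with hQ
  have eP : ∀ j, v < ((f j : ℕ) : ℝ) ↔ ¬ P j := fun j =>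
    ⟨fun H => not_lt.2 H.le, fun H => lt_of_le_of_ne (not_lt.1 H) (hne (f j)).1.symm⟩
  have eQ : ∀ j, h < ((π (f j) : ℕ) : ℝ) ↔ ¬ Q j := fun j =>
    ⟨fun H => not_lt.2 H.le, fun H => lt_of_le_of_ne (not_lt.1 H) (hne (f j)).2.symm⟩
  simp only [eP, eQ] at h1 h2 h3 h4
  change ∃! j, P j ∧ ¬ Q j at h1
  change ∃! j, P j ∧ Q j at h3
  change ∃! j, ¬ P j ∧ Q j at h4
  have KP : ∀ i, P i ↔ i < 2 := by
    refine lt_two_iff_of_quadrants (fun i i' hii h' => ?_) h3.exists h1.exists h4.exists h2.exists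
    have : f i < f i' := f.strictMono hii
    have : ((f i : ℕ) : ℝ) < (f i' : ℕ) := by exact_mod_cast this
    exact this.trans h'
  have KQ : ∀ i, Q (σ.symm i) ↔ i < 2 := by
    have tr : ∀ R : Fin 4 → Prop, (∃! i, R i) → ∃ i, R (σ.symm i) := by
      rintro R ⟨i, hi, -⟩
      exact ⟨σ i, by simpa using hi⟩
    have h1 := tr _ h1
    have h2 := tr _ h2
    have h3 := tr _ h3
    have h4 := tr _ h4
    refine lt_two_iff_of_quadrants (P := fun i => Q (σ.symm i)) (Q := fun i => P (σ.symm i))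
      (fun i i' hii h' => ?_) (by simpa only [and_comm] using h3)
      (by simpa only [and_comm] using h4) (by simpa only [and_comm] using h1)
      (by simpa only [and_comm] using h2)
    have : π (f (σ.symm i)) < π (f (σ.symm i')) := (hocc _ _).1 (by simpa using hii)
    have : ((π (f (σ.symm i)) : ℕ) : ℝ) < (π (f (σ.symm i')) : ℕ) := by exact_mod_cast this
    exact this.trans h'
  have KQ' : ∀ i, Q i ↔ σ i < 2 := fun i => by simpa using KQ (σ i)
  intro i i' e1 e2
  rw [← KP, ← KP] at e1
  rw [← KQ', ← KQ'] at e2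
  by_cases hp : P i <;> by_cases hq : Q i
  · exact h3.unique ⟨hp, hq⟩ ⟨e1.1 hp, e2.1 hq⟩
  · exact h1.unique ⟨hp, hq⟩ ⟨e1.1 hp, fun h => hq (e2.2 h)⟩
  · exact h4.unique ⟨hp, hq⟩ ⟨fun h => hp (e1.2 h), e2.1 hq⟩
  · exact h2.unique ⟨hp, hq⟩ ⟨fun h => hp (e1.2 h), fun h => hq (e2.2 h)⟩

end Grouping

namespace Grouping

/-! ### Rectangles and 4-cycles -/

/-- The four oriented edges `e 0, …, e 3` form an aligned rectangle: they are `(a, b)`, `(a, d)`,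
`(c, b)`, `(c, d)` for some nodes `a, b, c, d`. -/
def Aligned {E V : Type*} (s t : E → V) (e : Fin 4 → E) : Prop :=
  (s (e 0) = s (e 1) ∧ s (e 2) = s (e 3)) ∧ (t (e 0) = t (e 2) ∧ t (e 1) = t (e 3))

instance {E V : Type*} [DecidableEq V] (s t : E → V) : DecidablePred (Aligned s t) :=
  fun _ => inferInstanceAs (Decidable (_ ∧ _))

/-- Let `p_v` be the position of the value `v`. If the two small values are in different halves,
and so are the two large ones, then positions `0` and `2` form one of these pairs of values and
`1` and `3` the other one, or the same holds with `2` and `3` exchanged. -/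
theorem spread_cases : ∀ p₀ p₁ p₂ p₃ : Fin 4, [p₀, p₁, p₂, p₃].Nodup →
    ¬ (p₀ < 2 ↔ p₁ < 2) → ¬ (p₂ < 2 ↔ p₃ < 2) →
    (((p₀, p₁) = (0, 2) ∨ (p₀, p₁) = (2, 0)) ∧ ((p₂, p₃) = (1, 3) ∨ (p₂, p₃) = (3, 1))) ∨
    (((p₀, p₁) = (1, 3) ∨ (p₀, p₁) = (3, 1)) ∧ ((p₂, p₃) = (0, 2) ∨ (p₂, p₃) = (2, 0))) ∨
    (((p₀, p₁) = (0, 3) ∨ (p₀, p₁) = (3, 0)) ∧ ((p₂, p₃) = (1, 2) ∨ (p₂, p₃) = (2, 1))) ∨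
    (((p₀, p₁) = (1, 2) ∨ (p₀, p₁) = (2, 1)) ∧ ((p₂, p₃) = (0, 3) ∨ (p₂, p₃) = (3, 0))) := by
  decide

/-- In a pattern with one point in each quadrant, the points of the same lower or upper half are
those at positions `0, 2` and `1, 3`, or those at positions `0, 3` and `1, 2`. -/
theorem spread_pairs {σ : Equiv.Perm (Fin 4)} (hσ : Spread σ) :
    (∀ {V : Type} (t : Fin 4 → V), (t (σ.symm 0) = t (σ.symm 1) ∧ t (σ.symm 2) = t (σ.symm 3)) ↔
      (t 0 = t 2 ∧ t 1 = t 3)) ∨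
    (∀ {V : Type} (t : Fin 4 → V), (t (σ.symm 0) = t (σ.symm 1) ∧ t (σ.symm 2) = t (σ.symm 3)) ↔
      (t 0 = t 3 ∧ t 1 = t 2)) := by
  have hd : [σ.symm 0, σ.symm 1, σ.symm 2, σ.symm 3].Nodup := by simp
  have h01 : ¬ (σ.symm 0 < 2 ↔ σ.symm 1 < 2) := fun h => by
    have := hσ _ _ h (by simp)
    simp at this
  have h23 : ¬ (σ.symm 2 < 2 ↔ σ.symm 3 < 2) := fun h => by
    have := hσ _ _ h (by simp)
    simp at this
  rcases spread_cases _ _ _ _ hd h01 h23 with ⟨h, h'⟩ | ⟨h, h'⟩ | ⟨h, h'⟩ | ⟨h, h'⟩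
  · left
    intro V t
    rcases h with h | h <;> rcases h' with h' | h' <;>
      simp only [Prod.mk.injEq] at h h' <;> rw [h.1, h.2, h'.1, h'.2] <;> grind
  · left
    intro V t
    rcases h with h | h <;> rcases h' with h' | h' <;>
      simp only [Prod.mk.injEq] at h h' <;> rw [h.1, h.2, h'.1, h'.2] <;> grind
  · right
    intro V t
    rcases h with h | h <;> rcases h' with h' | h' <;>
      simp only [Prod.mk.injEq] at h h' <;> rw [h.1, h.2, h'.1, h'.2] <;> grind
  · right
    intro V t
    rcases h with h | h <;> rcases h' with h' | h' <;>
      simp only [Prod.mk.injEq] at h h' <;> rw [h.1, h.2, h'.1, h'.2] <;> grind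

/-- The number of rectangles does not depend on the pattern, since exchanging the two items on
the right turns one case of `spread_pairs` into the other one. -/
theorem card_rectangles_eq {σ : Equiv.Perm (Fin 4)} (hσ : Spread σ) {E V : Type} [Fintype E]
    [DecidableEq V] (s t : E → V) :
    (Finset.univ.filter fun e : Fin 4 → E => (s (e 0) = s (e 1) ∧ s (e 2) = s (e 3)) ∧
      (t (e (σ.symm 0)) = t (e (σ.symm 1)) ∧ t (e (σ.symm 2)) = t (e (σ.symm 3)))).card =
    (Finset.univ.filter fun e : Fin 4 → E => Aligned s t e).card := by
  rcases spread_pairs hσ with h | h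
  · congr 1
    ext e
    simp only [Finset.mem_filter, Finset.mem_univ, true_and]
    simp only [Aligned, h fun i => t (e i)]
  · refine Finset.card_equiv (Equiv.arrowCongr (Equiv.swap 2 3) (Equiv.refl E)) fun e => ?_
    simp only [Finset.mem_filter, Finset.mem_univ, true_and]
    simp only [Aligned, h fun i => t (e i)]
    have h0 : Equiv.swap (2 : Fin 4) 3 0 = 0 := by decide
    have h1 : Equiv.swap (2 : Fin 4) 3 1 = 1 := by decide
    simp [Equiv.arrowCongr, h0, h1, eq_comm]

section Degenerate

variable {E V : Type} [Fintype E] [DecidableEq V] {s t : E → V}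

/-- A rectangle with `a = c` is determined by two edges `(a, b)`, `(a, d)` with the same source. -/
theorem card_degenerate_left (hinj : ∀ i j, s i = s j → t i = t j → i = j) :
    (Finset.univ.filter fun e : Fin 4 → E =>
    Aligned s t e ∧ s (e 0) = s (e 2)).card =
    (Finset.univ.filter fun p : E × E => s p.1 = s p.2).card := by
  symm
  refine Finset.card_bij (fun p _ => ![p.1, p.2, p.1, p.2]) ?_ ?_ ?_
  · intro p hp
    simp only [Finset.mem_filter, Finset.mem_univ, true_and] at hp
    simp only [Finset.mem_filter, Finset.mem_univ, true_and]
    simp [Aligned, hp]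
  · intro p _ q _ h
    exact Prod.ext (congrFun h 0) (congrFun h 1)
  · intro e he
    simp only [Finset.mem_filter, Finset.mem_univ, true_and] at he
    simp only [Aligned] at he
    obtain ⟨⟨⟨h1, h2⟩, h3, h4⟩, h5⟩ := he
    have e02 := hinj _ _ h5 h3
    have e13 := hinj _ _ (h1.symm.trans (h5.trans h2)) h4
    refine ⟨(e 0, e 1), by simpa using h1, ?_⟩
    ext i
    fin_cases i
    exacts [rfl, rfl, e02, e13]

/-- A rectangle with `b = d` is determined by two edges `(a, b)`, `(c, b)` with the same target. -/
theorem card_degenerate_right (hinj : ∀ i j, s i = s j → t i = t j → i = j) :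
    (Finset.univ.filter fun e : Fin 4 → E =>
    Aligned s t e ∧ t (e 0) = t (e 1)).card =
    (Finset.univ.filter fun p : E × E => t p.1 = t p.2).card := by
  symm
  refine Finset.card_bij (fun p _ => ![p.1, p.1, p.2, p.2]) ?_ ?_ ?_
  · intro p hp
    simp only [Finset.mem_filter, Finset.mem_univ, true_and] at hp
    simp only [Finset.mem_filter, Finset.mem_univ, true_and]
    simp [Aligned, hp]
  · intro p _ q _ h
    exact Prod.ext (congrFun h 0) (congrFun h 2)
  · intro e he
    simp only [Finset.mem_filter, Finset.mem_univ, true_and] at he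
    simp only [Aligned] at he
    obtain ⟨⟨⟨h1, h2⟩, h3, h4⟩, h5⟩ := he
    have e01 := hinj _ _ h1 h5
    have e23 := hinj _ _ h2 (h3.symm.trans (h5.trans h4))
    refine ⟨(e 0, e 2), by simpa using h3, ?_⟩
    ext i
    fin_cases i
    exacts [rfl, e01, rfl, e23]

theorem card_degenerate_both (hinj : ∀ i j, s i = s j → t i = t j → i = j) :
    (Finset.univ.filter fun e : Fin 4 → E =>
    (Aligned s t e ∧ s (e 0) = s (e 2)) ∧ (Aligned s t e ∧ t (e 0) = t (e 1))).card =
    Fintype.card E := by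
  symm
  refine Finset.card_bij (fun p _ => ![p, p, p, p]) ?_ ?_ ?_
  · intro p _
    simp only [Finset.mem_filter, Finset.mem_univ, true_and]
    simp [Aligned]
  · intro p _ q _ h
    exact congrFun h 0
  · intro e he
    simp only [Finset.mem_filter, Finset.mem_univ, true_and] at he
    simp only [Aligned] at he
    obtain ⟨⟨⟨⟨h1, h2⟩, h3, h4⟩, h5⟩, -, h6⟩ := he
    have e01 := hinj _ _ h1 h6
    have e02 := hinj _ _ h5 h3
    have e23 := hinj _ _ h2 (h3.symm.trans (h6.trans h4))
    refine ⟨e 0, by simp, ?_⟩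
    ext i
    fin_cases i
    exacts [rfl, e01, e02, e02.trans e23]

/-- By inclusion and exclusion, the number of degenerate rectangles is `2 * D - L`, where `L` is
the number of edges and `D` is the number of pairs of edges with the same source, or with the
same target; so there is a non-degenerate rectangle if and only if there are more than that. -/
theorem exists_nondegenerate_iff (hinj : ∀ i j, s i = s j → t i = t j → i = j) {D : ℕ}
    (hs : (Finset.univ.filter fun p : E × E => s p.1 = s p.2).card = D)
    (ht : (Finset.univ.filter fun p : E × E => t p.1 = t p.2).card = D) :
    (∃ e : Fin 4 → E, Aligned s t e ∧ s (e 0) ≠ s (e 2) ∧ t (e 0) ≠ t (e 1)) ↔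
      2 * D < (Finset.univ.filter fun e : Fin 4 → E => Aligned s t e).card + Fintype.card E := by
  classical
  set A := Finset.univ.filter fun e : Fin 4 → E => Aligned s t e with hA
  set P := Finset.univ.filter fun e : Fin 4 → E => Aligned s t e ∧ s (e 0) = s (e 2) with hP
  set Q := Finset.univ.filter fun e : Fin 4 → E => Aligned s t e ∧ t (e 0) = t (e 1) with hQ
  have h1 : P.card = D := (card_degenerate_left hinj).trans hs
  have h2 : Q.card = D := (card_degenerate_right hinj).trans ht
  have h3 : (P ∩ Q).card = Fintype.card E := by
    rw [← card_degenerate_both hinj, hP, hQ, ← Finset.filter_and]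
  have h4 := Finset.card_union_add_card_inter P Q
  have hsub : P ∪ Q ⊆ A := by
    intro e he
    simp only [hP, hQ, hA, Finset.mem_union, Finset.mem_filter] at he ⊢
    tauto
  have h5 : (P ∪ Q).card < A.card ↔ ∃ e ∈ A, e ∉ P ∪ Q := by
    constructor
    · exact Finset.exists_mem_notMem_of_card_lt_card
    · rintro ⟨e, he, he'⟩
      exact Finset.card_lt_card ⟨hsub, fun h => he' (h he)⟩
  have h6 : (∃ e ∈ A, e ∉ P ∪ Q) ↔
      ∃ e : Fin 4 → E, Aligned s t e ∧ s (e 0) ≠ s (e 2) ∧ t (e 0) ≠ t (e 1) := by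
    refine exists_congr fun e => ?_
    simp only [hP, hQ, hA, Finset.mem_union, Finset.mem_filter, Finset.mem_univ, true_and]
    tauto
  rw [← h6, ← h5]
  omega

end Degenerate

theorem hasFourCycle_iff {V : Type*} (G : SimpleGraph V) : HasFourCycle G ↔
    ∃ a b c d, G.Adj a b ∧ G.Adj c b ∧ G.Adj c d ∧ G.Adj a d ∧ a ≠ c ∧ b ≠ d := by
  constructor
  · rintro ⟨v, w, hw, hl⟩
    match w, hw, hl with
    | .cons (v := b) h1 (.cons (v := c) h2 (.cons (v := d) h3 (.cons h4 .nil))), hw, _ =>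
      have := hw.support_nodup
      simp at this
      exact ⟨v, b, c, d, h1, h2.symm, h3, h4.symm, by grind, by grind⟩
  · rintro ⟨a, b, c, d, hab, hcb, hcd, had, hac, hbd⟩
    refine ⟨a, .cons hab (.cons hcb.symm (.cons hcd (.cons had.symm .nil))), ?_, rfl⟩
    have := hab.ne
    have := hcb.ne
    have := hcd.ne
    have := had.ne
    rw [SimpleGraph.Walk.cons_isCycle_iff]
    simp [SimpleGraph.Walk.isPath_def]
    grind

/-- A graph given by its oriented edges, which are pairwise different, has a 4-cycle if and only
if the oriented edges form a non-degenerate aligned rectangle. -/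
theorem hasFourCycle_iff_exists_aligned {E V : Type*} {G : SimpleGraph V} {s t : E → V}
    (hG : ∀ u v, G.Adj u v ↔ ∃ j, s j = u ∧ t j = v) : HasFourCycle G ↔
      ∃ e : Fin 4 → E, Aligned s t e ∧ s (e 0) ≠ s (e 2) ∧ t (e 0) ≠ t (e 1) := by
  rw [hasFourCycle_iff]
  constructor
  · rintro ⟨a, b, c, d, hab, hcb, hcd, had, hac, hbd⟩
    obtain ⟨j0, h0, h0'⟩ := (hG _ _).1 hab
    obtain ⟨j1, h1, h1'⟩ := (hG _ _).1 had
    obtain ⟨j2, h2, h2'⟩ := (hG _ _).1 hcb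
    obtain ⟨j3, h3, h3'⟩ := (hG _ _).1 hcd
    exact ⟨![j0, j1, j2, j3], by simp [Aligned, *], by simp [*], by simp [*]⟩
  · rintro ⟨e, ⟨⟨h1, h2⟩, h3, h4⟩, h5, h6⟩
    exact ⟨s (e 0), t (e 0), s (e 2), t (e 1), (hG _ _).2 ⟨e 0, rfl, rfl⟩,
      (hG _ _).2 ⟨e 2, rfl, h3.symm⟩, (hG _ _).2 ⟨e 3, h2.symm, h4.symm⟩,
      (hG _ _).2 ⟨e 1, h1.symm, rfl⟩, h5, h6⟩

end Grouping

/-! ### The oriented edges of an encoded graph -/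

namespace GraphInput

open Grouping

variable (x : GraphInput)

/-- The number of oriented edges. -/
abbrev len : ℕ := 2 * x.edges.length

/-- The word of the encoding that holds the source of the oriented edge `j`: the oriented edges
`2 * i` and `2 * i + 1` are the two orientations of edge number `i`. -/
def word (j : ℕ) : ℕ := x.encode.getD (j + 2) 0

/-- The source of an oriented edge. -/
def src (j : Fin x.len) : Fin x.n :=
  if (j : ℕ) % 2 = 0 then (x.edges[(j : ℕ) / 2]'(by have := j.2; unfold len at this; omega)).1
  else (x.edges[(j : ℕ) / 2]'(by have := j.2; unfold len at this; omega)).2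

theorem getD_flatMap_pair {α : Type*} (f g : α → ℕ) (l : List α) (j : ℕ) (hj : j / 2 < l.length) :
    (l.flatMap fun e => [f e, g e]).getD j 0 =
      if j % 2 = 0 then f l[j / 2] else g l[j / 2] := by
  induction l generalizing j with
  | nil => simp at hj
  | cons a l ih =>
    match j with
    | 0 => simp
    | 1 => simp
    | j + 2 =>
      have h1 : (j + 2) / 2 = j / 2 + 1 := by omega
      have h2 : (j + 2) % 2 = j % 2 := by omega
      have := ih (j := j) (by simpa [h1] using hj)
      simp only [h1, h2, List.getElem_cons_succ]
      rw [← this]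
      simp

theorem word_eq_src (j : Fin x.len) : x.word j = x.src j := by
  have hj : (j : ℕ) / 2 < x.edges.length := by have := j.2; unfold len at this; omega
  have := getD_flatMap_pair (fun e : Fin x.n × Fin x.n => (e.1 : ℕ)) (fun e => (e.2 : ℕ))
    x.edges j hj
  simp only [word, encode, List.getD_cons_succ]
  rw [this, src]
  split_ifs <;> rfl

theorem xor_one_eq (j : ℕ) : j ^^^ 1 = if j % 2 = 0 then j + 1 else j - 1 := by
  split_ifs with h
  · exact Nat.xor_one_of_even (Nat.even_iff.2 h)
  · exact Nat.xor_one_of_odd (Nat.odd_iff.2 (by omega))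

theorem xor_one_lt {m j : ℕ} (hj : j < 2 * m) : j ^^^ 1 < 2 * m := by
  rw [xor_one_eq]; split_ifs <;> omega

/-- Reversing the orientation. -/
def rev : Equiv.Perm (Fin x.len) :=
  Function.Involutive.toPerm (fun j => ⟨(j : ℕ) ^^^ 1, xor_one_lt j.2⟩) fun j => by
    ext; simp

theorem rev_val (j : Fin x.len) : (x.rev j : ℕ) = (j : ℕ) ^^^ 1 := rfl

/-- The orientations of edge number `i` go forth and back. -/
theorem src_pair (j : Fin x.len) (hj : (j : ℕ) / 2 < x.edges.length) :
    (x.src j, x.src (x.rev j)) =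
      if (j : ℕ) % 2 = 0 then x.edges[(j : ℕ) / 2] else x.edges[(j : ℕ) / 2].swap := by
  have h1 : (x.rev j : ℕ) / 2 = (j : ℕ) / 2 := by
    rw [rev_val, xor_one_eq]; split_ifs <;> omega
  have h2 : (x.rev j : ℕ) % 2 = 0 ↔ ¬ (j : ℕ) % 2 = 0 := by
    rw [rev_val, xor_one_eq]; split_ifs <;> omega
  unfold src
  simp only [h1, h2]
  split_ifs <;> simp_all [Prod.swap]

theorem half_lt (j : Fin x.len) : (j : ℕ) / 2 < x.edges.length := by
  have := j.2; unfold len at this; omega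

theorem adj_iff (u v : Fin x.n) :
    x.graph.Adj u v ↔ ∃ j, x.src j = u ∧ x.src (x.rev j) = v := by
  have hpair : (∃ j, x.src j = u ∧ x.src (x.rev j) = v) ↔
      ∃ j, (x.src j, x.src (x.rev j)) = (u, v) := by simp
  rw [x.mem_edges, hpair]
  constructor
  · rintro (h | h)
    · obtain ⟨i, hi, he⟩ := List.getElem_of_mem h
      refine ⟨⟨2 * i, by unfold len; omega⟩, ?_⟩
      rw [src_pair _ _ (by simpa using hi)]
      simpa using he
    · obtain ⟨i, hi, he⟩ := List.getElem_of_mem h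
      have h2 : (2 * i + 1) / 2 = i := by omega
      refine ⟨⟨2 * i + 1, by unfold len; omega⟩, ?_⟩
      rw [src_pair _ _ (by simpa [h2] using hi)]
      simp [h2, he, Nat.add_mod]
  · rintro ⟨j, hj⟩
    rw [src_pair _ _ (x.half_lt j)] at hj
    split_ifs at hj with h
    · left; rw [← hj]; exact List.getElem_mem _
    · right
      have : x.edges[(j : ℕ) / 2]'(x.half_lt j) = (v, u) := by
        rw [← Prod.swap_swap (x.edges[(j : ℕ) / 2]'(x.half_lt j)), hj]; rfl
      rw [← this]; exact List.getElem_mem _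

/-- Different oriented edges have different ends. -/
theorem eq_of_src_eq (i j : Fin x.len) (h : x.src i = x.src j)
    (h' : x.src (x.rev i) = x.src (x.rev j)) : i = j := by
  have hp : (x.src i, x.src (x.rev i)) = (x.src j, x.src (x.rev j)) := by rw [h, h']
  have hs : ∀ k : Fin x.len, s(x.src k, x.src (x.rev k)) =
      (x.edges.map fun e => s(e.1, e.2))[(k : ℕ) / 2]'(by simpa using x.half_lt k) := by
    intro k
    have := src_pair x k (x.half_lt k)
    simp only [List.getElem_map]
    split_ifs at this with hk
    · rw [← this]
    · rw [Sym2.eq_swap]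
      have h2 := congrArg Prod.swap this
      rw [Prod.swap_swap] at h2
      rw [← h2]; rfl
  have h2 : (i : ℕ) / 2 = (j : ℕ) / 2 := by
    have e : s(x.src i, x.src (x.rev i)) = s(x.src j, x.src (x.rev j)) := by rw [h, h']
    rw [hs i, hs j] at e
    exact (List.Nodup.getElem_inj_iff x.nodup).1 e
  by_contra hij
  have hrev : x.rev i = j := by
    have hne : (i : ℕ) ≠ j := fun h => hij (Fin.ext h)
    ext
    rw [rev_val, xor_one_eq]
    split_ifs <;> omega
  have hadj : x.graph.Adj (x.src i) (x.src (x.rev i)) := (x.adj_iff _ _).2 ⟨i, rfl, rfl⟩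
  rw [hrev, ← h] at hadj
  exact hadj.ne rfl

/-- The sum of the degrees of the sources of all oriented edges. -/
def degSum : ℕ := ∑ j ∈ Finset.range x.len, deg x.word x.len (x.word j)

theorem card_filter_src_eq : (Finset.univ.filter
    fun p : Fin x.len × Fin x.len => x.src p.1 = x.src p.2).card = x.degSum := by
  classical
  have h1 : ∀ j : Fin x.len, (∑ i : Fin x.len, if x.src i = x.src j then 1 else 0) =
      deg x.word x.len (x.word j) := by
    intro j
    rw [deg, Finset.card_filter, Finset.sum_range]
    simp only [word_eq_src, Fin.ext_iff]
  rw [degSum, Finset.sum_range, Finset.card_filter, Fintype.sum_prod_type_right]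
  exact Finset.sum_congr rfl fun j _ => h1 j

/-- The alternating count of the pattern decides whether the graph has a 4-cycle. -/
theorem hasFourCycle_iff_altCount {σ : Equiv.Perm (Fin 4)} (hσ : Spread σ) :
    HasFourCycle x.graph ↔ (2 * x.degSum : ℤ) < altCount x.word σ x.rev + x.len := by
  have ht : (Finset.univ.filter fun p : Fin x.len × Fin x.len =>
      x.src (x.rev p.1) = x.src (x.rev p.2)).card = x.degSum := by
    rw [← card_filter_src_eq]
    refine Finset.card_equiv (Equiv.prodCongr x.rev x.rev) fun p => ?_
    simp
  rw [hasFourCycle_iff_exists_aligned x.adj_iff,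
    exists_nondegenerate_iff x.eq_of_src_eq x.card_filter_src_eq ht, altCount_eq_card hσ,
    ← card_rectangles_eq hσ]
  simp only [word_eq_src, Fin.val_inj, Fintype.card_fin]
  norm_cast

end GraphInput

/-! ### The program that detects 4-cycles -/

namespace Grouping

variable {w : ℕ → ℕ} {L : ℕ}

theorem fill_succ (u j : ℕ) : fill w u (j + 1) = fill w u j + if w j = u then 1 else 0 := by
  unfold fill
  rw [Finset.range_add_one, Finset.filter_insert]
  split_ifs with h
  · rw [Finset.card_insert_of_notMem (by simp)]
  · rfl

theorem fill_pos_iff {u j : ℕ} : 0 < fill w u j ↔ ∃ i < j, w i = u := by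
  simp [fill, Finset.card_pos, Finset.Nonempty]

theorem first_eq_of_fill_eq_zero {j : ℕ} (h : fill w (w j) j = 0) : first w (w j) = j := by
  refine le_antisymm (first_le j) (not_lt.1 fun hlt => ?_)
  have : 0 < fill w (w j) j := fill_pos_iff.2 ⟨_, hlt, first_spec j⟩
  omega

theorem before_zero : before w L 0 = 0 := by simp [before]

theorem before_le (j : ℕ) : before w L j ≤ L := by
  simpa [before] using Finset.card_filter_le (Finset.range L) (fun i => first w (w i) < j)

/-- The update of the start of the next group: the difference `1 - fill w (w j) j` is `1` if `j` is
the first item of its group, and it is truncated to `0` otherwise. -/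
theorem before_succ (j : ℕ) : before w L (j + 1) =
    before w L j + (1 - fill w (w j) j) * deg w L (w j) := by
  rcases Nat.eq_zero_or_pos (fill w (w j) j) with h | h
  · have hj := first_eq_of_fill_eq_zero h
    have := before_add_deg (w := w) (L := L) (w j)
    rw [hj] at this
    rw [h, Nat.sub_zero, one_mul, this, before]
    congr 1
    refine Finset.filter_congr fun i _ => ?_
    rw [Nat.lt_succ_iff_lt_or_eq]
    refine or_congr_right ⟨fun e => first_inj (e.trans hj.symm), fun e => by rw [e, hj]⟩
  · have h1 : 1 - fill w (w j) j = 0 := by omega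
    rw [h1, zero_mul, add_zero, before, before]
    congr 1
    refine Finset.filter_congr fun i _ => ?_
    rw [Nat.lt_succ_iff_lt_or_eq, or_iff_left]
    intro e
    have h2 := first_spec (w := w) i
    rw [e] at h2
    obtain ⟨i', hi', e'⟩ := fill_pos_iff.1 h
    have := first_le (w := w) i'
    rw [e', h2, e] at this
    omega

end Grouping

namespace FourCycleProgram

open WordRAM Grouping

/-- Advance the loop counter `v[5]` and the number `v[4]` of remaining rounds. -/
def advance : List Prim := [.op .add 5 5 1, .op .sub 4 4 1]

/-- Prepare a loop over all oriented edges. -/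
def reset : List Prim := [.op .add 5 0 0, .op .add 4 2 0]

/-- The constants `1`, `2`, `L` and `2 * L`, where `L` is the number of oriented edges. -/
def initBlock : List Prim :=
  [.const 1 1, .const 25 2, .input 6 1, .op .add 2 6 6, .op .add 3 2 2]

/-- Array `16` counts the edges with a given source. -/
def degBody : List Prim :=
  [.op .add 6 5 25, .input 7 6, .load 16 8 7, .op .add 8 8 1, .store 16 7 8] ++ advance

/-- Array `17` gets the starts of the groups, array `18` counts the edges of each group that have
been seen, and array `19` gets the slots; `v[22]` sums up degrees, and `v[23]` is the start of the
next group. -/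
def slotBody : List Prim :=
  [.op .add 6 5 25, .input 7 6, .load 18 8 7, .op .sub 9 1 8, .load 17 10 7, .op .mul 11 9 23,
    .op .add 10 10 11, .store 17 7 10, .load 16 12 7, .op .mul 11 9 12, .op .add 23 23 11,
    .op .add 22 22 12, .op .add 10 10 8, .store 19 5 10, .op .add 8 8 1, .store 18 7 8] ++ advance

/-- Look up the starts, slots and degrees for both ends of an edge. -/
def lookup : List Prim :=
  [.op .add 6 5 25, .input 7 6, .op .xor 9 5 1, .op .add 8 9 25, .input 8 8, .load 17 10 7,
    .load 19 11 5, .op .add 10 10 11, .load 16 11 7, .load 17 12 8, .load 19 13 9,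
    .op .add 12 12 13, .load 16 13 8]

/-- Write the point of class `k` of an edge. -/
def point (σ : Equiv.Perm (Fin 4)) (a b c d : Bool) (z : ℕ) (k : Fin 4) : List Prim :=
  [.op .add 14 10 (if k < 2 then 0 else 3), .op .add 14 14 (if lag a b k then 11 else 0),
    .op .add 14 14 1, .op .add 15 12 (if σ k < 2 then 0 else 3),
    .op .add 15 15 (if lag c d (σ k) then 13 else 0), .store z 14 15]

/-- Write the four points of an edge. -/
def pointsBody (σ : Equiv.Perm (Fin 4)) (a b c d : Bool) (z : ℕ) : List Prim :=
  lookup ++ (point σ a b c d z 0 ++ (point σ a b c d z 1 ++ (point σ a b c d z 2 ++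
    (point σ a b c d z 3 ++ advance))))

/-- The sign of the call number `z` is negative. -/
def odd (z : ℕ) : Bool := xor (xor (z.testBit 0) (z.testBit 1)) (xor (z.testBit 2) (z.testBit 3))

/-- The variable that sums up the answers of the calls with the same sign as call number `z`. -/
def accVar (z : ℕ) : ℕ := if odd z then 21 else 20

/-- Write the permutation number `z`, where the bits of `z` say how to break the ties, call the pattern counting program, and add the answer. -/
def phase (σ : Equiv.Perm (Fin 4)) (p : Program) (z : ℕ) : Com :=
  .seq (.block ([.op .add 6 3 3, .store z 0 6] ++ reset))
    (.seq (.loop 4 (.block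
        (pointsBody σ (z.testBit 0) (z.testBit 1) (z.testBit 2) (z.testBit 3) z)))
      (.seq (.call p z) (.block [.op .add (accVar z) (accVar z) (bank z 0)])))

/-- The first `z` phases. -/
def phases (σ : Equiv.Perm (Fin 4)) (p : Program) : ℕ → Com
  | 0 => .block []
  | z + 1 => .seq (phases σ p z) (phase σ p z)

/-- Compare the number of rectangles with the number of degenerate ones. The truncated difference
`1 - (1 - y)` is `0` for `y = 0` and `1` otherwise. -/
def finalBlock : List Prim :=
  [.op .add 6 20 2, .op .add 7 21 22, .op .add 7 7 22, .op .sub 8 6 7, .op .sub 8 1 8,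
    .op .sub 24 1 8]

/-- The part of the program that is written in the structured language. -/
def main (σ : Equiv.Perm (Fin 4)) (p : Program) : Com :=
  .seq (.block (initBlock ++ reset)) (.seq (.loop 4 (.block degBody)) (.seq (.block reset)
    (.seq (.loop 4 (.block slotBody)) (.seq (phases σ p 16) (.block finalBlock)))))

variable (x : GraphInput)

/-- The environment in which the program runs on the graph `x`. -/
def env (B : ℕ) : Env := ⟨fun a => x.encode.getD a 0, x.len + 2, B⟩

/-- The variables that hold constants. -/
structure Consts (V : Store) : Prop where
  v0 : V.var 0 = 0
  v1 : V.var 1 = 1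
  v2 : V.var 2 = x.len
  v3 : V.var 3 = 2 * x.len
  v25 : V.var 25 = 2

/-- The loop counters before round `j`. -/
structure Round (j : ℕ) (V : Store) : Prop extends Consts x V where
  v5 : V.var 5 = j
  v4 : V.var 4 = x.len - j

theorem Consts.of_eq {V V' : Store} (h : Consts x V)
    (h' : ∀ r, r < 4 ∨ r = 25 → V'.var r = V.var r) : Consts x V' :=
  ⟨by rw [h' 0 (by norm_num), h.v0], by rw [h' 1 (by norm_num), h.v1],
    by rw [h' 2 (by norm_num), h.v2], by rw [h' 3 (by norm_num), h.v3],
    by rw [h' 25 (by norm_num), h.v25]⟩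

variable {x}

/-- The word bound `B` leaves enough room, where `b` bounds the words in the simulated runs. -/
structure Room (x : GraphInput) (b B : ℕ) : Prop where
  sq : 100 * ((x.n + x.len + b + 10) * (x.n + x.len + b + 10)) ≤ B

theorem Room.linear {b B : ℕ} (h : Room x b B) : 1000 * (x.n + x.len + b + 10) ≤ B := by
  have := h.sq
  have : 10 * (x.n + x.len + b + 10) ≤ (x.n + x.len + b + 10) * (x.n + x.len + b + 10) :=
    Nat.mul_le_mul_right _ (by omega)
  omega

theorem deg_le (w : ℕ → ℕ) (L u : ℕ) : deg w L u ≤ L := by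
  have := start_add_deg_le_length (w := w) (L := L) u; omega

theorem sum_deg_le (j : ℕ) :
    ∑ i ∈ Finset.range j, deg x.word x.len (x.word i) ≤ j * x.len := by
  simpa using Finset.sum_le_card_nsmul (Finset.range j) _ x.len
    fun i _ => deg_le x.word x.len (x.word i)

theorem word_lt {j : ℕ} (hj : j < x.len) : x.word j < x.n := by
  rw [x.word_eq_src ⟨j, hj⟩]; exact Fin.isLt _

/-! #### Counting the degrees -/

/-- The invariant of the first loop. -/
structure DegInv (x : GraphInput) (j : ℕ) (V : Store) : Prop extends Round x j V where
  deg : ∀ u, V.arr 16 u = fill x.word u j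
  arr : ∀ z, z ≠ 16 → ∀ i, V.arr z i = 0
  var : ∀ r, 20 ≤ r → r ≠ 25 → V.var r = 0

theorem degBody_spec {b B : ℕ} (hB : Room x b B) {j : ℕ} (hj : j < x.len) {V : Store}
    (h : DegInv x j V) : OkBlock (env x B) degBody V ∧
      DegInv x (j + 1) (evalBlock (env x B) degBody V) := by
  have hlin := hB.linear
  have hw := word_lt hj
  have hf : fill x.word (x.word j) j ≤ j := by
    simpa [fill] using Finset.card_filter_le (Finset.range j) (fun i => x.word i = x.word j)
  have e := h.v0; have e1 := h.v1; have e2 := h.v2; have e3 := h.v3; have e25 := h.v25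
  have e5 := h.v5; have e4 := h.v4
  have hin : (env x B).inp (j + 2) = x.word j := rfl
  have hbase : (env x B).base = x.len + 2 := rfl
  have hbound : (env x B).bound = B := rfl
  refine ⟨?_, ?_⟩
  · simp [degBody, advance, OkBlock, Prim.Ok, Prim.eval, Store.assign, Store.set, Op.eval,
      e5, e25, e4, e1, hin, h.deg, hbase, hbound]
    omega
  · refine ⟨⟨⟨?_, ?_, ?_, ?_, ?_⟩, ?_, ?_⟩, ?_, ?_, ?_⟩
    all_goals simp [degBody, advance, evalBlock, Prim.eval, Store.assign, Store.set, Op.eval,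
      e5, e25, e4, e1, e2, e3, e, hin, h.deg]
    · omega
    · intro u
      rw [fill_succ, Function.update_apply]
      by_cases hu : u = x.word j
      · subst hu; simp
      · simp [hu, Ne.symm hu, h.deg]
    · intro z hz i
      rw [Function.update_of_ne hz]
      exact h.arr z hz i
    · intro r hr hr'
      repeat rw [Function.update_of_ne (by omega)]
      exact h.var r hr hr'

/-! #### Computing the slots -/

/-- The invariant of the second loop. -/
structure SlotInv (x : GraphInput) (j : ℕ) (V : Store) : Prop extends Round x j V where
  deg : ∀ u, V.arr 16 u = deg x.word x.len u
  start : ∀ u, 0 < fill x.word u j → V.arr 17 u = start x.word x.len u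
  start_zero : ∀ u, fill x.word u j = 0 → V.arr 17 u = 0
  fill : ∀ u, V.arr 18 u = fill x.word u j
  slot : ∀ i < j, V.arr 19 i = slot x.word x.len i
  v22 : V.var 22 = ∑ i ∈ Finset.range j, Grouping.deg x.word x.len (x.word i)
  v23 : V.var 23 = before x.word x.len j
  arr : ∀ z < 16, ∀ i, V.arr z i = 0
  var : ∀ r, 20 ≤ r → r ≠ 25 → r ≠ 22 → r ≠ 23 → V.var r = 0

theorem slotBody_spec {b B : ℕ} (hB : Room x b B) {j : ℕ} (hj : j < x.len) {V : Store}
    (h : SlotInv x j V) : OkBlock (env x B) slotBody V ∧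
      SlotInv x (j + 1) (evalBlock (env x B) slotBody V) := by
  have hlin := hB.linear
  have hsq := hB.sq
  have hw := word_lt hj
  have hf := fill_lt_deg (w := x.word) hj
  have hd := start_add_deg_le_length (w := x.word) (L := x.len) (x.word j)
  have hb1 := before_le (w := x.word) (L := x.len) j
  -- this bounds the new value of `v[23]`
  have hb2 := before_le (w := x.word) (L := x.len) (j + 1)
  have hbs := before_succ (w := x.word) (L := x.len) j
  have hsum := sum_deg_le (x := x) j
  have hsum' : j * x.len ≤ (x.n + x.len + b + 10) * (x.n + x.len + b + 10) :=
    Nat.mul_le_mul (by omega) (by omega)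
  -- the group of `j` starts at `before j` if it has not been seen yet
  have hst : V.arr 17 (x.word j) + (1 - fill x.word (x.word j) j) * before x.word x.len j =
      start x.word x.len (x.word j) := by
    rcases Nat.eq_zero_or_pos (fill x.word (x.word j) j) with h0 | h0
    · rw [h.start_zero _ h0, h0, start, first_eq_of_fill_eq_zero h0]; simp
    · rw [h.start _ h0, show 1 - fill x.word (x.word j) j = 0 by omega]; simp
  have hm : (1 - fill x.word (x.word j) j) * before x.word x.len j ≤ before x.word x.len j := by
    simpa using Nat.mul_le_mul_right (before x.word x.len j)
      (by omega : 1 - fill x.word (x.word j) j ≤ 1)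
  have e := h.v0; have e1 := h.v1; have e2 := h.v2; have e3 := h.v3; have e25 := h.v25
  have e5 := h.v5; have e4 := h.v4; have e22 := h.v22; have e23 := h.v23
  have hin : (env x B).inp (j + 2) = x.word j := rfl
  have hbase : (env x B).base = x.len + 2 := rfl
  have hbound : (env x B).bound = B := rfl
  refine ⟨?_, ?_⟩
  · simp [slotBody, advance, OkBlock, Prim.Ok, Prim.eval, Store.assign, Store.set, Op.eval,
      e5, e25, e4, e1, hin, h.deg, h.fill, e22, e23, hst, hbase, hbound]
    omega
  · refine ⟨⟨⟨?_, ?_, ?_, ?_, ?_⟩, ?_, ?_⟩, ?_, ?_, ?_, ?_, ?_, ?_, ?_, ?_, ?_⟩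
    all_goals simp [slotBody, advance, evalBlock, Prim.eval, Store.assign, Store.set, Op.eval,
      e5, e25, e4, e1, e2, e3, e, hin, h.deg, h.fill, e22, e23, hst]
    · omega
    · intro u hu
      rw [fill_succ] at hu
      by_cases huw : u = x.word j
      · subst huw; simp
      · rw [Function.update_of_ne huw]
        exact h.start u (by simpa [Ne.symm huw] using hu)
    · intro u hu
      rw [fill_succ] at hu
      have huw : u ≠ x.word j := by rintro rfl; simp at hu
      rw [Function.update_of_ne huw]
      exact h.start_zero u (by omega)
    · intro u
      rw [fill_succ]
      by_cases huw : u = x.word j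
      · subst huw; simp
      · simp [huw, Ne.symm huw, h.fill]
    · intro i hi
      by_cases hij : i = j
      · subst hij; simp [Grouping.slot]
      · rw [Function.update_of_ne hij]; exact h.slot i (by omega)
    · rw [Finset.sum_range_succ]
    · exact hbs.symm
    · intro z hz i
      rw [Function.update_of_ne (by omega), Function.update_of_ne (by omega),
        Function.update_of_ne (by omega)]
      exact h.arr z hz i
    · intro r hr hr1 hr2 hr3
      repeat rw [Function.update_of_ne (by omega)]
      exact h.var r hr hr1 hr2 hr3

/-! #### Writing a permutation -/

/-- What the loop that writes a permutation needs: the tables are complete. -/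
structure Tables (x : GraphInput) (V : Store) : Prop where
  deg : ∀ u, V.arr 16 u = deg x.word x.len u
  start : ∀ i < x.len, V.arr 17 (x.word i) = start x.word x.len (x.word i)
  slot : ∀ i < x.len, V.arr 19 i = slot x.word x.len i

/-- The invariant of the loop that writes the permutation number `z`, started in `V₀`. -/
structure PointInv (x : GraphInput) (σ : Equiv.Perm (Fin 4)) (a b c d : Bool) (z : ℕ) (V₀ : Store)
    (j : ℕ) (V : Store) : Prop extends Round x j V where
  zero : V.arr z 0 = 4 * x.len
  point : ∀ i < j, ∀ k, V.arr z (pos x.word x.len a b k i + 1) =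
    pos x.word x.len c d (σ k) (i ^^^ 1)
  beyond : ∀ i, 4 * x.len < i → V.arr z i = 0
  frame_arr : ∀ z', z' ≠ z → V.arr z' = V₀.arr z'
  frame_var : ∀ r, 20 ≤ r → V.var r = V₀.var r

/-- What `lookup` provides. -/
structure Looked (x : GraphInput) (j : ℕ) (V : Store) : Prop extends Round x j V where
  v10 : V.var 10 = start x.word x.len (x.word j) + slot x.word x.len j
  v11 : V.var 11 = deg x.word x.len (x.word j)
  v12 : V.var 12 = start x.word x.len (x.word (j ^^^ 1)) + slot x.word x.len (j ^^^ 1)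
  v13 : V.var 13 = deg x.word x.len (x.word (j ^^^ 1))

theorem lookup_spec {b B : ℕ} (hB : Room x b B) {j : ℕ} (hj : j < x.len) {V : Store}
    (h : Round x j V) (ht : Tables x V) : OkBlock (env x B) lookup V ∧
      Looked x j (evalBlock (env x B) lookup V) ∧ (evalBlock (env x B) lookup V).arr = V.arr ∧
      ∀ r, 20 ≤ r → (evalBlock (env x B) lookup V).var r = V.var r := by
  have hlin := hB.linear
  have hj' : j ^^^ 1 < x.len := GraphInput.xor_one_lt hj
  have hw := word_lt hj
  have hw' := word_lt hj'
  have hf := fill_lt_deg (w := x.word) hj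
  have hf' := fill_lt_deg (w := x.word) hj'
  have hd := start_add_deg_le_length (w := x.word) (L := x.len) (x.word j)
  have hd' := start_add_deg_le_length (w := x.word) (L := x.len) (x.word (j ^^^ 1))
  have hs : slot x.word x.len j ≤ x.len := by unfold slot; omega
  have hs' : slot x.word x.len (j ^^^ 1) ≤ x.len := by unfold slot; omega
  have e := h.v0; have e1 := h.v1; have e2 := h.v2; have e3 := h.v3; have e25 := h.v25
  have e5 := h.v5; have e4 := h.v4
  have hin : (env x B).inp (j + 2) = x.word j := rfl
  have hin' : (env x B).inp ((j ^^^ 1) + 2) = x.word (j ^^^ 1) := rfl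
  have hbase : (env x B).base = x.len + 2 := rfl
  have hbound : (env x B).bound = B := rfl
  refine ⟨?_, ⟨⟨⟨?_, ?_, ?_, ?_, ?_⟩, ?_, ?_⟩, ?_, ?_, ?_, ?_⟩, rfl, ?_⟩
  · simp [lookup, OkBlock, Prim.Ok, Prim.eval, Store.assign, Op.eval,
      e5, e25, e1, hin, hin', ht.deg, ht.start j hj, ht.start _ hj', ht.slot j hj, ht.slot _ hj',
      hbase, hbound]
    omega
  all_goals simp [lookup, evalBlock, Prim.eval, Store.assign, Op.eval,
      e5, e25, e4, e1, e2, e3, e, hin, hin', ht.deg, ht.start j hj, ht.start _ hj', ht.slot j hj,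
      ht.slot _ hj']
  intro r hr
  repeat rw [Function.update_of_ne (by omega)]

theorem point_spec {b B : ℕ} (hB : Room x b B) (σ : Equiv.Perm (Fin 4)) (a' b' c d : Bool)
    {z : ℕ} (hz : z < 32) (k : Fin 4) {j : ℕ} (hj : j < x.len) {V : Store} (h : Looked x j V) :
    OkBlock (env x B) (point σ a' b' c d z k) V ∧
      (evalBlock (env x B) (point σ a' b' c d z k) V).arr =
        (V.set z (pos x.word x.len a' b' k j + 1) (pos x.word x.len c d (σ k) (j ^^^ 1))).arr ∧
      ∀ r, r ≠ 14 → r ≠ 15 →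
        (evalBlock (env x B) (point σ a' b' c d z k) V).var r = V.var r := by
  have hlin := hB.linear
  have hj' : j ^^^ 1 < x.len := GraphInput.xor_one_lt hj
  have hx := pos_lt (w := x.word) (a := a') (b := b') (k := k) hj
  have hy := pos_lt (w := x.word) (a := c) (b := d) (k := σ k) hj'
  have hbase : (env x B).base = x.len + 2 := rfl
  have hbound : (env x B).bound = B := rfl
  have g1 : V.var (if k < 2 then 0 else 3) = if k < 2 then 0 else 2 * x.len := by
    split_ifs; exacts [h.v0, h.v3]
  have g2 : V.var (if lag a' b' k then 11 else 0) =
      if lag a' b' k then deg x.word x.len (x.word j) else 0 := by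
    split_ifs; exacts [h.v11, h.v0]
  have g3 : V.var (if σ k < 2 then 0 else 3) = if σ k < 2 then 0 else 2 * x.len := by
    split_ifs; exacts [h.v0, h.v3]
  have g4 : V.var (if lag c d (σ k) then 13 else 0) =
      if lag c d (σ k) then deg x.word x.len (x.word (j ^^^ 1)) else 0 := by
    split_ifs; exacts [h.v13, h.v0]
  have n1 : (if k < 2 then 0 else 3 : ℕ) < 14 := by split_ifs <;> norm_num
  have n2 : (if lag a' b' k then 11 else 0 : ℕ) < 14 := by split_ifs <;> norm_num
  have n3 : (if σ k < 2 then 0 else 3 : ℕ) < 14 := by split_ifs <;> norm_num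
  have n4 : (if lag c d (σ k) then 13 else 0 : ℕ) < 14 := by split_ifs <;> norm_num
  have hxe : V.var 10 + V.var (if k < 2 then 0 else 3) + V.var (if lag a' b' k then 11 else 0) =
      pos x.word x.len a' b' k j := by
    rw [g1, g2, h.v10, pos]; ring
  have hye : V.var 12 + V.var (if σ k < 2 then 0 else 3) +
      V.var (if lag c d (σ k) then 13 else 0) = pos x.word x.len c d (σ k) (j ^^^ 1) := by
    rw [g3, g4, h.v12, pos]; ring
  have e1 := h.v1
  unfold point
  generalize (if k < 2 then 0 else 3 : ℕ) = r1 at *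
  generalize (if lag a' b' k then 11 else 0 : ℕ) = r2 at *
  generalize (if σ k < 2 then 0 else 3 : ℕ) = r3 at *
  generalize (if lag c d (σ k) then 13 else 0 : ℕ) = r4 at *
  have u2 : ∀ v v' : ℕ, Function.update (Function.update V.var 14 v) 14 v' r3 = V.var r3 :=
    fun _ _ => by rw [Function.update_of_ne n3.ne, Function.update_of_ne n3.ne]
  refine ⟨?_, ?_, ?_⟩
  · simp [OkBlock, Prim.Ok, Prim.eval, Store.assign, Op.eval, n2.ne, n3.ne, n4.ne,
      Function.update_of_ne (show r4 ≠ 15 by omega), e1, hxe, hye, hbase, hbound, hz]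
    omega
  · simp [evalBlock, Prim.eval, Store.assign, Store.set, Op.eval, n2.ne, n3.ne, n4.ne,
      Function.update_of_ne (show r4 ≠ 15 by omega), e1, hxe, hye]
  · intro r h14 h15
    simp [evalBlock, Prim.eval, Store.assign, Store.set, h14, h15]

theorem Looked.of_eq {j : ℕ} {V V' : Store} (h : Looked x j V)
    (h' : ∀ r, r ≠ 14 → r ≠ 15 → V'.var r = V.var r) : Looked x j V' := by
  have g : ∀ r, r ≠ 14 ∧ r ≠ 15 → V'.var r = V.var r := fun r hr => h' r hr.1 hr.2
  exact ⟨⟨h.toConsts.of_eq x fun r hr => h' r (by omega) (by omega),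
    (g 5 (by norm_num)).trans h.v5, (g 4 (by norm_num)).trans h.v4⟩,
    (g 10 (by norm_num)).trans h.v10, (g 11 (by norm_num)).trans h.v11,
    (g 12 (by norm_num)).trans h.v12, (g 13 (by norm_num)).trans h.v13⟩

theorem pointsBody_spec {b' B : ℕ} (hB : Room x b' B) (σ : Equiv.Perm (Fin 4)) (a b c d : Bool)
    {z : ℕ} (hz : z < 16) {j : ℕ} (hj : j < x.len) {V₀ V : Store} (ht : Tables x V₀)
    (h : PointInv x σ a b c d z V₀ j V) : OkBlock (env x B) (pointsBody σ a b c d z) V ∧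
      PointInv x σ a b c d z V₀ (j + 1) (evalBlock (env x B) (pointsBody σ a b c d z) V) := by
  have hz32 : z < 32 := by omega
  have ht' : Tables x V := by
    refine ⟨?_, ?_, ?_⟩
    · rw [h.frame_arr 16 (by omega)]; exact ht.deg
    · rw [h.frame_arr 17 (by omega)]; exact ht.start
    · rw [h.frame_arr 19 (by omega)]; exact ht.slot
  obtain ⟨ok, l, ha, hv⟩ := lookup_spec hB hj h.toRound ht'
  obtain ⟨ok0, ha0, hv0⟩ := point_spec hB σ a b c d hz32 0 hj l
  have l0 := l.of_eq hv0
  obtain ⟨ok1, ha1, hv1⟩ := point_spec hB σ a b c d hz32 1 hj l0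
  have l1 := l0.of_eq hv1
  obtain ⟨ok2, ha2, hv2⟩ := point_spec hB σ a b c d hz32 2 hj l1
  have l2 := l1.of_eq hv2
  obtain ⟨ok3, ha3, hv3⟩ := point_spec hB σ a b c d hz32 3 hj l2
  have l3 := l2.of_eq hv3
  simp only [pointsBody, okBlock_append, evalBlock_append]
  set V1 := evalBlock (env x B) lookup V
  set W0 := evalBlock (env x B) (point σ a b c d z 0) V1
  set W1 := evalBlock (env x B) (point σ a b c d z 1) W0
  set W2 := evalBlock (env x B) (point σ a b c d z 2) W1
  set W3 := evalBlock (env x B) (point σ a b c d z 3) W2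
  have hlin := hB.linear
  have e1 := l3.v1; have e4 := l3.v4; have e5 := l3.v5
  have hbound : (env x B).bound = B := rfl
  -- the array `z` after the four stores
  have hz3 : W3.arr z = Function.update (Function.update (Function.update (Function.update
      (V.arr z) (pos x.word x.len a b 0 j + 1) (pos x.word x.len c d (σ 0) (j ^^^ 1)))
      (pos x.word x.len a b 1 j + 1) (pos x.word x.len c d (σ 1) (j ^^^ 1)))
      (pos x.word x.len a b 2 j + 1) (pos x.word x.len c d (σ 2) (j ^^^ 1)))
      (pos x.word x.len a b 3 j + 1) (pos x.word x.len c d (σ 3) (j ^^^ 1)) := by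
    simp [ha3, Store.set, ha2, ha1, ha0, ha]
  have hz3' : ∀ z', z' ≠ z → W3.arr z' = V.arr z' := by
    intro z' h'
    simp [ha3, Store.set, ha2, ha1, ha0, ha, h']
  have hvar : ∀ r, 20 ≤ r → W3.var r = V.var r := by
    intro r hr
    rw [hv3 r (by omega) (by omega), hv2 r (by omega) (by omega), hv1 r (by omega) (by omega),
      hv0 r (by omega) (by omega), hv r hr]
  have inj : ∀ k k' i, i ≤ j → pos x.word x.len a b k i = pos x.word x.len a b k' j →
      k = k' ∧ i = j := by
    intro k k' i hi hp
    have := @pos_injective x.word x.len a b (k, ⟨i, by omega⟩) (k', ⟨j, hj⟩) (by simpa using hp)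
    simpa using this
  have hconst : Consts x (evalBlock (env x B) advance W3) :=
    l3.toConsts.of_eq x fun r hr => by
      simp only [advance, evalBlock, Prim.eval, Store.assign]
      rw [Function.update_of_ne (by omega), Function.update_of_ne (by omega)]
  refine ⟨⟨ok, ok0, ok1, ok2, ok3, ?_⟩, ⟨hconst, ?_, ?_⟩, ?_, ?_, ?_, ?_, ?_⟩
  · simp [advance, OkBlock, Prim.Ok, Prim.eval, Store.assign, Op.eval, e1, e4, e5, hbound]
    omega
  · simp [advance, evalBlock, Prim.eval, Store.assign, Op.eval, e1, e5]
  · simp [advance, evalBlock, Prim.eval, Store.assign, Op.eval, e1, e4]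
    omega
  · change W3.arr z 0 = _
    rw [hz3]
    simpa [Function.update_apply] using h.zero
  · intro i hi k
    change W3.arr z _ = _
    rw [hz3]
    simp only [Function.update_apply, Nat.add_right_cancel_iff]
    rcases Nat.lt_succ_iff_lt_or_eq.1 hi with hi | rfl
    · have hne : ∀ k', pos x.word x.len a b k i ≠ pos x.word x.len a b k' j :=
        fun k' hp => hi.ne (inj k k' i hi.le hp).2
      simp only [hne, if_false]
      exact h.point i hi k
    · have hk : ∀ k', pos x.word x.len a b k i = pos x.word x.len a b k' i ↔ k = k' :=
        fun k' => ⟨fun hp => (inj k k' i le_rfl hp).1, fun hp => by rw [hp]⟩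
      simp only [hk]
      fin_cases k <;> simp
  · intro i hi
    change W3.arr z i = 0
    rw [hz3]
    have hne : ∀ k, i ≠ pos x.word x.len a b k j + 1 := by
      intro k hk
      have := pos_lt (w := x.word) (a := a) (b := b) (k := k) hj
      omega
    simp only [Function.update_apply, hne, if_false]
    exact h.beyond i hi
  · intro z' h'
    change W3.arr z' = _
    rw [hz3' z' h', h.frame_arr z' h']
  · intro r hr
    simp only [advance, evalBlock, Prim.eval, Store.assign]
    rw [Function.update_of_ne (by omega), Function.update_of_ne (by omega), hvar r hr,
      h.frame_var r hr]

end FourCycleProgram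

namespace FourCycleProgram

open WordRAM Grouping

/-! #### The calls of the pattern counting program -/

/-- The permutation that is written for call number `z`. -/
noncomputable def perm (x : GraphInput) (σ : Equiv.Perm (Fin 4)) (z : ℕ) :
    Equiv.Perm (Fin (4 * x.len)) :=
  edgePerm x.word σ x.rev (z.testBit 0) (z.testBit 1) (z.testBit 2) (z.testBit 3)

/-- The input words for the permutation `π`. -/
noncomputable def permWords (σ : Equiv.Perm (Fin 4)) {n : ℕ} (π : Equiv.Perm (Fin n)) : List ℕ :=
  (patternCounting σ).encode ⟨n, π⟩

/-- The program `p` counts the pattern `σ` in permutations of length `n` within `T` steps and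
with words below `b`. -/
def Counts (p : Program) (σ : Equiv.Perm (Fin 4)) (n T b : ℕ) : Prop :=
  ∀ π : Equiv.Perm (Fin n), (∀ t, (run p (permWords σ π) t).Bounded b) ∧
    Halted p (run p (permWords σ π) T) ∧ (run p (permWords σ π) T).reg 0 = patternCount σ π

variable {x : GraphInput} {σ : Equiv.Perm (Fin 4)} {p : Program} {T b B : ℕ}

theorem Counts.count_lt {n : ℕ} (h : Counts p σ n T b) (π : Equiv.Perm (Fin n)) :
    patternCount σ π < b := by
  rw [← (h π).2.2]; exact ((h π).1 T 0).1

/-- After the loop, array `z` holds the input words of the permutation number `z`: every position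
below `4 * L` belongs to a copy of an edge. -/
theorem PointInv.arr_eq {z : ℕ} {V₀ V : Store} (h : PointInv x σ (z.testBit 0) (z.testBit 1)
    (z.testBit 2) (z.testBit 3) z V₀ x.len V) (i : ℕ) :
    V.arr z i = (permWords σ (perm x σ z)).getD i 0 := by
  have hw : permWords σ (perm x σ z) =
      (4 * x.len) :: List.ofFn fun i => (perm x σ z i : ℕ) := rfl
  rw [hw]
  cases i with
  | zero => simpa using h.zero
  | succ q =>
    rw [List.getD_cons_succ]
    by_cases hq : q < 4 * x.len
    · obtain ⟨⟨k, j⟩, hkj⟩ := (posEquiv x.word x.len (z.testBit 0) (z.testBit 1)).surjective ⟨q, hq⟩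
      have hv : q = pos x.word x.len (z.testBit 0) (z.testBit 1) k j :=
        (congrArg Fin.val hkj).symm
      have hp : (perm x σ z ⟨q, hq⟩ : ℕ) =
          pos x.word x.len (z.testBit 2) (z.testBit 3) (σ k) ((j : ℕ) ^^^ 1) := by
        rw [← hkj]; simp [perm, edgePerm]; rfl
      rw [List.getD_eq_getElem _ _ (by simpa using hq), List.getElem_ofFn, hp, hv]
      exact h.point j j.2 k
    · rw [List.getD_eq_default _ _ (by simpa using hq)]
      exact h.beyond _ (by omega)

/-- The invariant before phase `z`. -/
structure PhaseInv (x : GraphInput) (σ : Equiv.Perm (Fin 4)) (z : ℕ) (V : Store) : Prop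
    extends Consts x V, Tables x V where
  arr : ∀ z', z ≤ z' → z' < 16 → ∀ i, V.arr z' i = 0
  bank : ∀ z', z ≤ z' → z' < 16 → ∀ r, V.var (bank z' r) = 0
  v22 : V.var 22 = x.degSum
  v20 : V.var 20 = ∑ i ∈ Finset.range z, if odd i then 0 else patternCount σ (perm x σ i)
  v21 : V.var 21 = ∑ i ∈ Finset.range z, if odd i then patternCount σ (perm x σ i) else 0

theorem sum_count_le (h : Counts p σ (4 * x.len) T b) (q : ℕ → Bool) (z : ℕ) :
    (∑ i ∈ Finset.range z, if q i then patternCount σ (perm x σ i) else 0) ≤ z * b := by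
  have h1 : ∀ i ∈ Finset.range z, (if q i then patternCount σ (perm x σ i) else 0) ≤ b := by
    intro i _
    split_ifs
    · exact (h.count_lt _).le
    · exact Nat.zero_le _
  simpa using Finset.sum_le_card_nsmul _ _ _ h1

theorem bank_ne_of_ne {z z' r r' : ℕ} (hz : z < 16) (hz' : z' < 16) (h : z' ≠ z) :
    bank z' r' ≠ bank z r := by
  unfold bank; omega

theorem phase_wp (hB : Room x b B) (hp : Counts p σ (4 * x.len) T b) {z : ℕ} (hz : z < 16)
    {V : Store} (h : PhaseInv x σ z V) :
    (phase σ p z).Wp (env x B) (240 * (x.len + 1) + 6 * T) (PhaseInv x σ (z + 1)) V := by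
  have hlin := hB.linear
  have hE : 32 < (env x B).bound := by change 32 < B; omega
  have hbase : (env x B).base = x.len + 2 := rfl
  have hbound : (env x B).bound = B := rfl
  have e := h.v0; have e1 := h.v1; have e2 := h.v2; have e3 := h.v3; have e25 := h.v25
  set a₁ := z.testBit 0 with ha₁
  set a₂ := z.testBit 1 with ha₂
  set a₃ := z.testBit 2 with ha₃
  set a₄ := z.testBit 3 with ha₄
  have W1 : (Com.block ([.op .add 6 3 3, .store z 0 6] ++ reset)).Wp (env x B) 24
      (PointInv x σ a₁ a₂ a₃ a₄ z V 0) V := by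
    refine Com.wp_block hE ?_ ?_
    · simp [reset, OkBlock, Prim.Ok, Prim.eval, Store.assign, Store.set, Op.eval, e, e2, e3,
        hbase, hbound]
      omega
    · refine ⟨⟨⟨?_, ?_, ?_, ?_, ?_⟩, ?_, ?_⟩, ?_, ?_, ?_, ?_, ?_⟩
      all_goals simp [reset, evalBlock, Prim.eval, Store.assign, Store.set, Op.eval, e, e1, e2,
        e3, e25]
      · ring
      · intro i hi
        rw [Function.update_of_ne (by omega)]
        exact h.arr z le_rfl hz i
      · intro z' hz'
        rw [Function.update_of_ne hz']
      · intro r hr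
        repeat rw [Function.update_of_ne (by omega)]
  have W2 : ∀ V', PointInv x σ a₁ a₂ a₃ a₄ z V 0 V' →
      (Com.loop 4 (.block (pointsBody σ a₁ a₂ a₃ a₄ z))).Wp (env x B) (x.len * (234 + 2) + 1)
        (PointInv x σ a₁ a₂ a₃ a₄ z V x.len) V' := fun V' hV' =>
    Com.wp_loop (PointInv x σ a₁ a₂ a₃ a₄ z V)
      (fun j hj U hU => ⟨by rw [hU.v4]; omega,
        have hs := pointsBody_spec hB σ a₁ a₂ a₃ a₄ hz hj h.toTables hU
        Com.wp_block hE hs.1 hs.2⟩)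
      (fun U hU => by rw [hU.v4]; omega) hV'
  have W3 : ∀ V', PointInv x σ a₁ a₂ a₃ a₄ z V x.len V' → (Com.call p z).Wp (env x B) (6 * T)
      (fun V'' => PointInv x σ a₁ a₂ a₃ a₄ z V x.len V' ∧
        Simulates z V' V'' (run p (permWords σ (perm x σ z)) T)) V' := by
    intro V' hV'
    refine (Com.wp_call hE (by omega : z < 32) (b := b) ?_ ?_ hV'.arr_eq (hp _).1
      (hp _).2.1).mono le_rfl fun V'' h'' => ⟨hV', h''⟩
    · rw [hbase, hbound]; omega
    · intro r
      rw [hV'.frame_var _ (by unfold WordRAM.bank; omega)]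
      exact h.bank z le_rfl hz r
  have W4 : ∀ V', (∃ U, PointInv x σ a₁ a₂ a₃ a₄ z V x.len U ∧
      Simulates z U V' (run p (permWords σ (perm x σ z)) T)) →
      (Com.block [.op .add (accVar z) (accVar z) (bank z 0)]).Wp (env x B) 6
        (PhaseInv x σ (z + 1)) V' := by
    rintro V' ⟨U, hU, hS⟩
    have hres : V'.var (bank z 0) = patternCount σ (perm x σ z) := by
      rw [hS.reg, (hp _).2.2]
    have hlow : ∀ r, 20 ≤ r → r < 32 → V'.var r = V.var r := by
      intro r hr hr'
      rw [hS.frame_var r (fun r' => by unfold WordRAM.bank; omega), hU.frame_var r hr]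
    have hcon : Consts x V' := hU.toConsts.of_eq x fun r hr =>
      hS.frame_var r (fun r' => by unfold WordRAM.bank; omega)
    have harr : ∀ z', z' ≠ z → V'.arr z' = V.arr z' := fun z' hz' => by
      rw [hS.frame_arr z' hz', hU.frame_arr z' hz']
    have hbank : ∀ z', z' ≠ z → z' < 16 → ∀ r, V'.var (bank z' r) = V.var (bank z' r) := by
      intro z' hz' hz16 r
      rw [hS.frame_var _ (fun r' => bank_ne_of_ne hz hz16 hz'),
        hU.frame_var _ (by unfold WordRAM.bank; omega)]
    have hacc : accVar z = 20 ∨ accVar z = 21 := by unfold accVar; split_ifs <;> simp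
    have hcnt := hp.count_lt (perm x σ z)
    have hle : V'.var (accVar z) ≤ 16 * b := by
      have hzb : z * b ≤ 16 * b := Nat.mul_le_mul_right _ hz.le
      rcases hacc with ha | ha <;> rw [ha, hlow _ (by norm_num) (by norm_num)]
      · rw [h.v20]
        refine le_trans ?_ ((sum_count_le hp (fun i => !odd i) z).trans hzb)
        refine (Finset.sum_congr rfl fun i _ => ?_).le
        cases odd i <;> simp
      · rw [h.v21]
        exact (sum_count_le hp odd z).trans hzb
    refine Com.wp_block hE ?_ ?_
    · simp only [OkBlock, Prim.Ok, Op.eval, hres, hbound, and_true]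
      omega
    · have hother : ∀ r, r ≠ accVar z →
          (evalBlock (env x B) [.op .add (accVar z) (accVar z) (bank z 0)] V').var r =
            V'.var r := fun r hr => by
        simp [evalBlock, Prim.eval, Store.assign, hr]
      refine ⟨hcon.of_eq x fun r hr => hother r (by omega), ⟨?_, ?_, ?_⟩, ?_, ?_, ?_, ?_, ?_⟩
      · intro u
        change V'.arr 16 u = _
        rw [harr 16 (by omega)]; exact h.deg u
      · intro i hi
        change V'.arr 17 _ = _
        rw [harr 17 (by omega)]; exact h.start i hi
      · intro i hi
        change V'.arr 19 _ = _
        rw [harr 19 (by omega)]; exact h.slot i hi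
      · intro z' h1 h2 i
        change V'.arr z' i = 0
        rw [harr z' (by omega)]; exact h.arr z' (by omega) h2 i
      · intro z' h1 h2 r
        rw [hother _ (by unfold WordRAM.bank; omega), hbank z' (by omega) h2]
        exact h.bank z' (by omega) h2 r
      · rw [hother _ (by omega), hlow _ (by norm_num) (by norm_num), h.v22]
      · rw [Finset.sum_range_succ, ← h.v20, ← hlow 20 (by norm_num) (by norm_num)]
        cases ho : odd z <;>
          simp [evalBlock, Prim.eval, Store.assign, Op.eval, accVar, ho, hres]
      · rw [Finset.sum_range_succ, ← h.v21, ← hlow 21 (by norm_num) (by norm_num)]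
        cases ho : odd z <;>
          simp [evalBlock, Prim.eval, Store.assign, Op.eval, accVar, ho, hres]
  refine (W1.seq fun V1 h1 => (W2 V1 h1).seq fun V2 h2 => (W3 V2 h2).seq fun V3 h3 =>
    W4 V3 ⟨V2, h3⟩).mono ?_ fun _ hV => hV
  omega

theorem phases_wp (hB : Room x b B) (hp : Counts p σ (4 * x.len) T b) {V : Store}
    (h : PhaseInv x σ 0 V) (z : ℕ) (hz : z ≤ 16) :
    (phases σ p z).Wp (env x B) (z * (240 * (x.len + 1) + 6 * T)) (PhaseInv x σ z) V := by
  have hE : 32 < (env x B).bound := by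
    change 32 < B
    have := hB.linear
    omega
  induction z with
  | zero => exact (Com.wp_block (l := []) hE trivial h).mono (by simp) fun _ hV => hV
  | succ z ih =>
    refine ((ih (by omega)).seq fun V' hV' => phase_wp hB hp (by omega) hV').mono ?_ fun _ hV => hV
    rw [Nat.add_mul, Nat.one_mul]

/-- The sums over the calls with positive and with negative sign give the alternating count. -/
theorem altCount_eq_sub : altCount x.word σ x.rev =
    ((∑ i ∈ Finset.range 16, if odd i then 0 else patternCount σ (perm x σ i) : ℕ) : ℤ) -
    (∑ i ∈ Finset.range 16, if odd i then patternCount σ (perm x σ i) else 0 : ℕ) := by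
  unfold altCount perm
  simp [Finset.sum_range_succ, odd, Nat.testBit]
  ring

open Classical in
theorem main_wp (hσ : Spread σ) (hB : Room x b B) (hp : Counts p σ (4 * x.len) T b) :
    (main σ p).Wp (env x B) (5000 * (x.len + 1) + 96 * T)
      (fun V => Consts x V ∧ V.var 24 = if HasFourCycle x.graph then 1 else 0)
      ⟨fun _ => 0, fun _ _ => 0⟩ := by
  have hlin := hB.linear
  have hsq := hB.sq
  have hE : 32 < (env x B).bound := by change 32 < B; omega
  have hbase : (env x B).base = x.len + 2 := rfl
  have hbound : (env x B).bound = B := rfl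
  have hinp : (env x B).inp 1 = x.edges.length := rfl
  have W1 : (Com.block (initBlock ++ reset)).Wp (env x B) 42 (DegInv x 0)
      ⟨fun _ => 0, fun _ _ => 0⟩ := by
    refine Com.wp_block hE ?_ ?_
    · simp [initBlock, reset, OkBlock, Prim.Ok, Prim.eval, Store.assign, Op.eval, hinp, hbase,
        hbound]
      unfold GraphInput.len at hlin
      omega
    · refine ⟨⟨⟨?_, ?_, ?_, ?_, ?_⟩, ?_, ?_⟩, ?_, ?_, ?_⟩
      all_goals simp [initBlock, reset, evalBlock, Prim.eval, Store.assign, Op.eval, hinp, fill]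
      · ring
      · ring
      · ring
      · intro r hr hr'
        repeat rw [Function.update_of_ne (by omega)]
  have W2 : ∀ V, DegInv x 0 V → (Com.loop 4 (.block degBody)).Wp (env x B)
      (x.len * (42 + 2) + 1) (DegInv x x.len) V :=
    fun V hV => Com.wp_loop (DegInv x)
      (fun j hj U hU => ⟨by rw [hU.v4]; omega,
        Com.wp_block hE (degBody_spec hB hj hU).1 (degBody_spec hB hj hU).2⟩)
      (fun U hU => by rw [hU.v4]; omega) hV
  have W3 : ∀ V, DegInv x x.len V → (Com.block reset).Wp (env x B) 12 (SlotInv x 0) V := by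
    intro V h
    have e := h.v0; have e1 := h.v1; have e2 := h.v2; have e3 := h.v3; have e25 := h.v25
    refine Com.wp_block hE ?_ ?_
    · simp [reset, OkBlock, Prim.Ok, Prim.eval, Store.assign, Op.eval, e, e2, hbound]
      omega
    · refine ⟨⟨⟨?_, ?_, ?_, ?_, ?_⟩, ?_, ?_⟩, ?_, ?_, ?_, ?_, ?_, ?_, ?_, ?_, ?_⟩
      all_goals simp [reset, evalBlock, Prim.eval, Store.assign, Op.eval, e, e1, e2, e3, e25,
        h.deg, h.arr, fill, before_zero, h.var]
      · intro u; rfl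
      · intro z hz i; exact h.arr z (by omega) i
      · intro r hr h1 h2 h3
        repeat rw [Function.update_of_ne (by omega)]
        exact h.var r hr h1
  have W4 : ∀ V, SlotInv x 0 V → (Com.loop 4 (.block slotBody)).Wp (env x B) (x.len * (108 + 2) + 1)
      (SlotInv x x.len) V :=
    fun V hV => Com.wp_loop (SlotInv x)
      (fun j hj U hU => ⟨by rw [hU.v4]; omega,
        Com.wp_block hE (slotBody_spec hB hj hU).1 (slotBody_spec hB hj hU).2⟩)
      (fun U hU => by rw [hU.v4]; omega) hV
  have hphase : ∀ V, SlotInv x x.len V → PhaseInv x σ 0 V := fun V h =>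
    ⟨h.toConsts, ⟨h.deg, fun i hi => h.start _ (fill_pos_iff.2 ⟨i, hi, rfl⟩), h.slot⟩,
      fun z' _ hz' => h.arr z' hz',
      fun z' _ _ r => h.var _ (by unfold WordRAM.bank; omega) (by unfold WordRAM.bank; omega)
        (by unfold WordRAM.bank; omega) (by unfold WordRAM.bank; omega),
      h.v22, by simpa using h.var 20, by simpa using h.var 21⟩
  have W6 : ∀ V, PhaseInv x σ 16 V → (Com.block finalBlock).Wp (env x B) 36
      (fun V => Consts x V ∧ V.var 24 = if HasFourCycle x.graph then 1 else 0) V := by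
    intro V h
    have e1 := h.v1; have e2 := h.v2
    have hD : x.degSum ≤ (x.n + x.len + b + 10) * (x.n + x.len + b + 10) :=
      (sum_deg_le x.len).trans (Nat.mul_le_mul (by omega) (by omega))
    have h20 : V.var 20 ≤ 16 * b := by
      rw [h.v20]
      refine le_trans (Finset.sum_congr rfl fun i _ => ?_).le (sum_count_le hp (fun i => !odd i) 16)
      cases odd i <;> simp
    have h21 : V.var 21 ≤ 16 * b := by
      rw [h.v21]; exact sum_count_le hp odd 16
    have hiff := x.hasFourCycle_iff_altCount hσ
    rw [altCount_eq_sub, ← h.v20, ← h.v21, ← h.v22] at hiff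
    have hiff' : HasFourCycle x.graph ↔ 2 * V.var 22 + V.var 21 < V.var 20 + x.len := by
      rw [hiff]; omega
    rw [← h.v22] at hD
    refine Com.wp_block hE ?_ ⟨h.toConsts.of_eq x fun r hr => ?_, ?_⟩
    · simp [finalBlock, OkBlock, Prim.Ok, Prim.eval, Store.assign, Op.eval, e1, e2, hbound]
      omega
    · simp only [finalBlock, evalBlock, Prim.eval, Store.assign]
      repeat rw [Function.update_of_ne (by omega)]
    · simp only [hiff']
      simp [finalBlock, evalBlock, Prim.eval, Store.assign, Op.eval, e1, e2]
      split_ifs <;> omega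
  refine (W1.seq fun V1 h1 => (W2 V1 h1).seq fun V2 h2 => (W3 V2 h2).seq fun V3 h3 =>
    (W4 V3 h3).seq fun V4 h4 => (phases_wp hB hp (hphase V4 h4) 16 le_rfl).seq W6).mono ?_
    fun _ hV => hV
  omega

/-! #### The whole program -/

/-- The instructions that compute the base address of the arrays. -/
def prologue : List Instr :=
  [.const 0 1, .load 0 0, .op .add 0 0 0, .const 1 2, .op .add 2 0 1]

/-- The program that detects 4-cycles by means of a program `p` that counts the pattern `σ`. -/
def program (σ : Equiv.Perm (Fin 4)) (p : Program) : Program :=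
  prologue ++ (main σ p).code 5 ++ [.op .add 0 27 3]

theorem length_encode : x.encode.length = x.len + 2 := by
  simp [GraphInput.encode, Nat.mul_comm]

open Classical in
theorem program_reaches (hσ : Spread σ) (hB : Room x b B) (hp : Counts p σ (4 * x.len) T b)
    (hinit : (init x.encode).Bounded B) :
    ∃ t ≤ 5000 * (x.len + 1) + 96 * T + 6, ∃ s, Reaches (program σ p) B t (init x.encode) s ∧
      Halted (program σ p) s ∧ s.reg 0 = if HasFourCycle x.graph then 1 else 0 := by
  have hlin := hB.linear
  have hmain : CodeAt (program σ p) 5 ((main σ p).code 5) :=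
    codeAt_self prologue ((main σ p).code 5) [.op .add 0 27 3]
  have hpro : CodeAt (program σ p) 0 prologue := by
    have := codeAt_self [] prologue ((main σ p).code 5 ++ [.op .add 0 27 3])
    simpa [program] using this
  have hepi : CodeAt (program σ p) (5 + (main σ p).size) [.op .add 0 27 3] := by
    have := codeAt_self (prologue ++ (main σ p).code 5) [.op .add 0 27 3] []
    have hl : (prologue ++ (main σ p).code 5).length = 5 + (main σ p).size := by
      rw [List.length_append, Com.length_code]; rfl
    rwa [hl, List.append_nil] at this
  have hlen : (program σ p).length = 5 + (main σ p).size + 1 := by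
    simp [program, Com.length_code, prologue]; omega
  have h1 : x.encode.getD 1 0 = x.edges.length := rfl
  have hL : x.edges.length + x.edges.length = x.len := by unfold GraphInput.len; ring
  obtain ⟨c0, c1, c2, c3, c4, -⟩ := hpro
  set s0 := init x.encode with hs0
  set s1 : State := ⟨1, Function.update s0.reg 0 1, s0.mem⟩ with hs1
  have b1 : s1.Bounded B := hinit.update_reg _ _ (by omega)
  set s2 : State := ⟨2, Function.update s1.reg 0 x.edges.length, s1.mem⟩ with hs2
  have b2 : s2.Bounded B := b1.update_reg _ _ (by omega)
  set s3 : State := ⟨3, Function.update s2.reg 0 x.len, s2.mem⟩ with hs3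
  have b3 : s3.Bounded B := b2.update_reg _ _ (by omega)
  set s4 : State := ⟨4, Function.update s3.reg 1 2, s3.mem⟩ with hs4
  have b4 : s4.Bounded B := b3.update_reg _ _ (by omega)
  set s5 : State := ⟨5, Function.update s4.reg 2 (x.len + 2), s4.mem⟩ with hs5
  have b5 : s5.Bounded B := b4.update_reg _ _ (by omega)
  have e1 : (Instr.const 0 1).exec s0 = s1 := rfl
  have e2 : (Instr.load 0 0).exec s1 = s2 := by
    simp [Instr.exec, hs2, hs1, hs0, init]
    rfl
  have e3 : (Instr.op .add 0 0 0).exec s2 = s3 := by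
    simp [Instr.exec, hs3, hs2, Op.eval, hL]
  have e4 : (Instr.const 1 2).exec s3 = s4 := rfl
  have e5 : (Instr.op .add 2 0 1).exec s4 = s5 := by
    simp [Instr.exec, hs5, hs4, hs3, Op.eval]
  have hR : Rep (env x B) ⟨fun _ => 0, fun _ _ => 0⟩ s5 := by
    refine ⟨?_, fun r => ?_, fun a _ => rfl, fun z _ i => ?_⟩
    · simp [hs5, env]
    · simp [hs5, hs4, hs3, hs2, hs1, hs0, init]
    · change x.encode.getD _ 0 = 0
      refine List.getD_eq_default _ _ ?_
      rw [length_encode]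
      change x.len + 2 ≤ i * 32 + z + (x.len + 2)
      omega
  obtain ⟨t, ht, s', V', g1, g2, g3, g4, g5⟩ := main_wp hσ hB hp _ 5 hmain s5 rfl hR b5
  have hres : s'.reg 27 + s'.reg 3 = if HasFourCycle x.graph then 1 else 0 := by
    have h27 := g3.var 24
    have h3 := g3.var 0
    rw [g5] at h27
    rw [g4.v0] at h3
    simp only [Nat.zero_add, Nat.reduceAdd] at h27 h3
    rw [h27, h3, add_zero]
  have hend : (Instr.op .add 0 27 3).exec s' = ⟨s'.pc + 1, Function.update s'.reg 0
      (if HasFourCycle x.graph then 1 else 0), s'.mem⟩ := by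
    simp only [Instr.exec, Op.eval, hres]
  have bend : ((Instr.op .add 0 27 3).exec s').Bounded B := by
    rw [hend]
    refine g1.bounded_end.update_reg _ _ ?_
    split_ifs
    · exact (by omega : 1 < B)
    · exact (by omega : 0 < B)
  refine ⟨t + 1 + 1 + 1 + 1 + 1 + 1, by omega, (Instr.op .add 0 27 3).exec s', ?_, ?_, ?_⟩
  · refine .exec hinit c0 ?_
    rw [e1]
    refine .exec b1 c1 ?_
    rw [e2]
    refine .exec b2 c2 ?_
    rw [e3]
    refine .exec b3 c3 ?_
    rw [e4]
    refine .exec b4 c4 ?_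
    rw [e5]
    exact g1.trans (.exec g1.bounded_end (by rw [g2]; exact hepi.1) (.refl bend))
  · rw [hend, Halted, hlen, g2]
  · rw [hend]; simp

end FourCycleProgram

/-! ### The reduction and its running time -/

namespace FourCycleProgram

open WordRAM Grouping

theorem getD_le_foldr_max (l : List ℕ) (a : ℕ) : l.getD a 0 ≤ l.foldr max 0 := by
  induction l generalizing a with
  | nil => simp
  | cons b l ih =>
    cases a with
    | zero => simp
    | succ a => simpa using Or.inr (ih a)

theorem foldr_max_le {l : List ℕ} {k : ℕ} (h : ∀ a ∈ l, a ≤ k) : l.foldr max 0 ≤ k := by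
  induction l with
  | nil => simp
  | cons b l ih =>
    simp only [List.foldr_cons, max_le_iff]
    exact ⟨h b (by simp), ih fun a ha => h a (by simp [ha])⟩

theorem magnitude_permWords_le (σ : Equiv.Perm (Fin 4)) {n : ℕ} (π : Equiv.Perm (Fin n)) :
    magnitude (permWords σ π) ≤ 2 * n + 1 := by
  have hw : permWords σ π = n :: List.ofFn fun i => (π i : ℕ) := rfl
  have : (permWords σ π).foldr max 0 ≤ n := by
    refine foldr_max_le fun a ha => ?_
    rw [hw, List.mem_cons, List.mem_ofFn] at ha
    rcases ha with rfl | ⟨i, rfl⟩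
    · exact le_rfl
    · exact (π i).isLt.le
  have hl : (permWords σ π).length = n + 1 := by simp [hw]
  unfold magnitude
  omega

variable {σ : Equiv.Perm (Fin 4)} {p : Program}

theorem counts_of_solvesInTime {T : ℕ → ℕ} {c : ℕ}
    (hc : ∀ y, WordsBounded p c ((patternCounting σ).encode y))
    (hT : ∀ y, Halted p (run p ((patternCounting σ).encode y) (T ((patternCounting σ).size y))) ∧
      (run p ((patternCounting σ).encode y) (T ((patternCounting σ).size y))).reg 0 =
        (patternCounting σ).answer y) (n : ℕ) :
    Counts p σ n (T n) ((2 * n + 3) ^ c) := by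
  refine fun π => ⟨fun t a => ?_, hT ⟨n, π⟩⟩
  have hle : (magnitude (permWords σ π) + 2) ^ c ≤ (2 * n + 3) ^ c :=
    Nat.pow_le_pow_left (by have := magnitude_permWords_le σ π; omega) c
  exact ⟨(hc ⟨n, π⟩ t a).1.trans_le hle, (hc ⟨n, π⟩ t a).2.trans_le hle⟩

/-- The words of the simulated runs are bounded by a power of the magnitude of the graph. -/
theorem room_pow (x : GraphInput) (c : ℕ) :
    Room x ((2 * (4 * x.len) + 3) ^ c) ((magnitude x.encode + 2) ^ (6 * c + 10)) := by
  have hn : x.n ≤ x.encode.foldr max 0 := getD_le_foldr_max x.encode 0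
  have hl := length_encode (x := x)
  have hM : magnitude x.encode = x.encode.length + x.encode.foldr max 0 := rfl
  generalize magnitude x.encode = N at hM ⊢
  obtain ⟨M, hMN⟩ : ∃ M, M = N + 2 := ⟨_, rfl⟩
  rw [← hMN]
  have hM4 : 4 ≤ M := by omega
  have h3 : 2 * (4 * x.len) + 3 ≤ M ^ 3 := by
    have : 16 * M ≤ M ^ 3 := by
      rw [show M ^ 3 = M * M * M by ring]
      exact Nat.mul_le_mul_right _ (Nat.mul_le_mul hM4 hM4)
    omega
  have hb : (2 * (4 * x.len) + 3) ^ c ≤ M ^ (3 * c) := by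
    rw [pow_mul]; exact Nat.pow_le_pow_left h3 c
  have hS : x.n + x.len + (2 * (4 * x.len) + 3) ^ c + 10 ≤ M ^ (3 * c + 3) := by
    have h1 : 1 ≤ M ^ (3 * c) := Nat.one_le_pow _ _ (by omega)
    have h2 : M ≤ M * M ^ (3 * c) := by simpa using Nat.mul_le_mul_left M h1
    have h5 : M ^ (3 * c) ≤ M * M ^ (3 * c) := by
      simpa using Nat.mul_le_mul_right (M ^ (3 * c)) (by omega : 1 ≤ M)
    have h4 : 16 * (M * M ^ (3 * c)) ≤ M ^ (3 * c + 3) := by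
      rw [show M ^ (3 * c + 3) = M * M * (M * M ^ (3 * c)) by ring]
      exact Nat.mul_le_mul_right _ (Nat.mul_le_mul hM4 hM4)
    omega
  constructor
  calc 100 * _ ≤ M ^ 4 * (M ^ (3 * c + 3) * M ^ (3 * c + 3)) := by
        refine Nat.mul_le_mul ?_ (Nat.mul_le_mul hS hS)
        calc 100 ≤ 4 ^ 4 := by norm_num
          _ ≤ M ^ 4 := Nat.pow_le_pow_left hM4 4
    _ = M ^ (6 * c + 10) := by ring

theorem init_bounded (x : GraphInput) {k : ℕ} (hk : k ≠ 0) :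
    (init x.encode).Bounded ((magnitude x.encode + 2) ^ k) := by
  have h1 : magnitude x.encode + 2 ≤ (magnitude x.encode + 2) ^ k := Nat.le_self_pow hk _
  intro a
  refine ⟨?_, ?_⟩
  · change 0 < _
    omega
  · change x.encode.getD a 0 < _
    have := getD_le_foldr_max x.encode a
    have h2 : magnitude x.encode = x.encode.length + x.encode.foldr max 0 := rfl
    omega

/-- Detecting 4-cycles takes linear time and the time for counting the pattern in 16
permutations of length `8 * m`. -/
theorem solvesInTime {T : ℕ → ℕ} (hσ : Spread σ)
    (hp : SolvesInTime p (patternCounting σ) T) :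
    SolvesInTime (program σ p) fourCycleDetection
      fun m => 5000 * (2 * m + 1) + 96 * T (4 * (2 * m)) + 6 := by
  classical
  obtain ⟨⟨c, hc⟩, hT⟩ := hp
  have key : ∀ x : GraphInput,
      (∀ i, (run (program σ p) x.encode i).Bounded ((magnitude x.encode + 2) ^ (6 * c + 10))) ∧
      Halted (program σ p) (run (program σ p) x.encode
        (5000 * (x.len + 1) + 96 * T (4 * x.len) + 6)) ∧
      (run (program σ p) x.encode (5000 * (x.len + 1) + 96 * T (4 * x.len) + 6)).reg 0 =
        if HasFourCycle x.graph then 1 else 0 := by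
    intro x
    obtain ⟨t, ht, s, hs, hh, hr⟩ := program_reaches hσ (room_pow x c)
      (counts_of_solvesInTime hc hT (4 * x.len)) (init_bounded x (by omega))
    obtain ⟨h1, h2⟩ := hs.iterate_of_halted hh
    refine ⟨h2, ?_⟩
    rw [run, h1 _ ht]
    exact ⟨hh, hr⟩
  refine ⟨⟨6 * c + 10, fun x t a => (key x).1 t a⟩, fun x => ?_⟩
  obtain ⟨-, h1, h2⟩ := key x
  refine ⟨h1, h2.trans ?_⟩
  simp only [fourCycleDetection]

/-- The time bound of the reduction is `O(m ^ e)` if the time for counting is `O(n ^ e)`, for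
`e ≥ 1`. -/
theorem isBigO_time {T : ℕ → ℕ} {e : ℝ} (he : 1 ≤ e)
    (hT : (fun n => (T n : ℝ)) =O[atTop] fun n : ℕ => (n : ℝ) ^ e) :
    (fun m => ((5000 * (2 * m + 1) + 96 * T (4 * (2 * m)) + 6 : ℕ) : ℝ)) =O[atTop]
      fun m : ℕ => (m : ℝ) ^ e := by
  have h8 : Tendsto (fun m : ℕ => 4 * (2 * m)) atTop atTop :=
    tendsto_atTop_mono (fun m => (by omega : m ≤ 4 * (2 * m))) tendsto_id
  have h1 : (fun m => (T (4 * (2 * m)) : ℝ)) =O[atTop] fun m : ℕ => (m : ℝ) ^ e := by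
    refine (hT.comp_tendsto h8).trans (IsBigO.of_bound (8 ^ e) (Eventually.of_forall fun m => ?_))
    have hm : (((4 * (2 * m) : ℕ) : ℝ)) = 8 * (m : ℝ) := by push_cast; ring
    simp only [Function.comp_apply]
    rw [hm, Real.mul_rpow (by norm_num) (Nat.cast_nonneg m), norm_mul,
      Real.norm_of_nonneg (by positivity : (0 : ℝ) ≤ 8 ^ e)]
  have h2 : (fun m : ℕ => ((5000 * (2 * m + 1) + 6 : ℕ) : ℝ)) =O[atTop]
      fun m : ℕ => (m : ℝ) ^ e := by
    refine IsBigO.of_bound 15006 ((eventually_ge_atTop 1).mono fun m hm => ?_)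
    have hm' : (1 : ℝ) ≤ m := by exact_mod_cast hm
    have h3 : (m : ℝ) ≤ (m : ℝ) ^ e := by
      simpa using Real.rpow_le_rpow_of_exponent_le hm' he
    rw [Real.norm_of_nonneg (Nat.cast_nonneg _),
      Real.norm_of_nonneg (Real.rpow_nonneg (Nat.cast_nonneg m) e)]
    push_cast
    linarith
  refine (h2.add (h1.const_mul_left 96)).congr_left fun m => ?_
  push_cast
  ring

end FourCycleProgram

open FourCycleProgram Grouping in
theorem mainTheorem2 (hDKS : DahlgaardKnudsenStockelConjecture) :
    ∀ ε : ℝ, 0 < ε → ∀ σ : Equiv.Perm (Fin 4), IsNontrivialPattern σ →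
      ¬ WordRAM.SolvableInTime (patternCounting σ) (fun n => (n : ℝ) ^ (4 / 3 - ε : ℝ)) := by
  rintro ε hε σ hσ ⟨p, T, hp, hT⟩
  -- the linear overhead of the reduction is allowed only if the exponent is at least `1`
  refine hDKS (min ε (1 / 3)) (by positivity) ⟨program σ p, _,
    solvesInTime (spread_of_isNontrivialPattern hσ) hp, isBigO_time ?_ (hT.trans ?_)⟩
  · have := min_le_right ε (1 / 3)
    linarith
  · refine IsBigO.of_bound 1 ((eventually_ge_atTop 1).mono fun n hn => ?_)
    have hn' : (1 : ℝ) ≤ n := by exact_mod_cast hn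
    rw [one_mul, Real.norm_of_nonneg (Real.rpow_nonneg (Nat.cast_nonneg n) _),
      Real.norm_of_nonneg (Real.rpow_nonneg (Nat.cast_nonneg n) _)]
    refine Real.rpow_le_rpow_of_exponent_le hn' ?_
    have := min_le_left ε (1 / 3)
    linarith
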